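/- Let $q\in\mathbb N_0$, $\gamma\in(0,\pi/2)$ and $\kappa>0$. There is a constant $C>0$, depending only on $q$, $\gamma$ and $\kappa$, such that the following holds. Let $d\in\{2,3\}$ and let $\Omega\subset\mathbb R^d$ be open (for example a bounded Lipschitz domain) with a partition $\mathcal T=\{\tau\}$ of $\overline\Omega$ into finitely many closed cells with pairwise disjoint interiors, each cell being a triangle/tetrahedron or a quadrilateral/hexahedron (an injective affine image of the reference simplex, resp. an injective multilinear image of $[0,1]^d$); no quasi-uniformity is assumed. Let $r\ge 1$ and let $V_h$ be the space of all complex-valued $v\in H^1_0(\Omega)$ whose restriction to each cell belongs to the polynomial space ($P_r$ or $Q_r$, in the physical or in the reference variable) chosen for that cell. Define $\Delta_h\colon V_h\to V_h$ by $(-\Delta_h v,\chi)_\Omega=(\nabla v,\nabla\chi)_\Omega$ for all $\chi\in V_h$, and let $P_h\colon L^2(\Omega)\to V_h$ be the $L^2(\Omega)$-orthogonal projection. Let $0=t_0<t_1<\dots<t_M=T$, $I=(0,T)$, $I_m=(t_{m-1},t_m]$, $k_m=t_m-t_{m-1}$, with $\kappa^{-1}\le k_m/k_{m+1}\le\kappa$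 for $1\le m\le M-1$. Let $X_{kh}$ be the space of functions which on each $I_m$ are polynomials in $t$ of degree at most $q$ with coefficients in $V_h$; write $u_m^\pm=\lim_{\varepsilon\to0^+}u(t_m\pm\varepsilon)$, $[u]_m=u_m^+-u_m^-$, and $$B(u,\varphi)=\sum_{m=1}^M(\partial_t u,\varphi)_{I_m\times\Omega}+(\nabla u,\nabla\varphi)_{I\times\Omega}+\sum_{m=2}^M([u]_{m-1},\varphi_{m-1}^+)_\Omega+(u_0^+,\varphi_0^+)_\Omega .$$ Let $|\!|\!|\cdot|\!|\!|$ be any norm on $V_h$ for which there is a number $M_h$ with $$|\!|\!|(z+\Delta_h)^{-1}\chi|\!|\!|\le\frac{M_h}{|z|}|\!|\!|\chi|\!|\!|\qquad\text{for all }\chi\in V_h\text{ and all }z\in\mathbb C\setminus\Sigma_\gamma,\quad \Sigma_\gamma=\{z:|\arg z|\le\gamma\}\ (0\in\Sigma_\gamma).$$ Let $u_0\in L^2(\Omega)$ and let $u_{kh}\in X_{kh}$ be the solution of the homogeneous dG($q$)cG($r$) scheme $B(u_{kh},\varphi)=(u_0,\varphi_0^+)_\Omega$ for all $\varphi\in X_{kh}$.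 Then, for $m=1,\dots,M$, $$\sup_{t\in I_m}|\!|\!|\partial_t u_{kh}(t)|\!|\!|+\sup_{t\in I_m}|\!|\!|\Delta_h u_{kh}(t)|\!|\!|+k_m^{-1}|\!|\!|[u_{kh}]_{m-1}|\!|\!|\le\frac{C M_h}{t_m}|\!|\!|P_h u_0|\!|\!| ,$$ where $[u_{kh}]_0$ is understood as $u_{kh,0}^+-P_hu_0$. -/

import Mathlib

open MeasureTheory Filter Topology
open scoped ContDiff

noncomputable section

namespace DGFE

/-! ### The spaces `L²(Ω)` and `H¹₀(Ω)` (complex valued) -/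

/-- Euclidean space `ℝᵈ`. -/
abbrev Space (d : ℕ) : Type := EuclideanSpace ℝ (Fin d)

/-- `L²(Ω; ℂ)`. -/
abbrev L2 {d : ℕ} (Ω : Set (Space d)) : Type := Lp ℂ 2 (volume.restrict Ω)

/-- `L²(Ω; ℂᵈ)` with its Hilbert space structure. -/
abbrev L2Vec {d : ℕ} (Ω : Set (Space d)) : Type := PiLp 2 (fun _ : Fin d => L2 Ω)

/-- `φ ∈ C_c^∞(Ω; ℂ)`. -/
structure IsTestFunction {d : ℕ} (Ω : Set (Space d)) (φ : Space d → ℂ) : Prop where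
  smooth : ContDiff ℝ ∞ φ
  compact : HasCompactSupport φ
  support : tsupport φ ⊆ Ω

/-- The `i`-th classical partial derivative. -/
def partialDeriv {d : ℕ} (i : Fin d) (φ : Space d → ℂ) (x : Space d) : ℂ :=
  fderiv ℝ φ x (EuclideanSpace.single i 1)

/-- The set of all pairs `(φ, ∇φ)` with `φ ∈ C_c^∞(Ω)`, as a subspace of `L² × (L²)ᵈ`. -/
def testGraph {d : ℕ} (Ω : Set (Space d)) : Submodule ℂ (L2 Ω × L2Vec Ω) where
  carrier := {p | ∃ φ : Space d → ℂ, IsTestFunction Ω φ ∧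
    p.1 =ᵐ[volume.restrict Ω] φ ∧ ∀ i, p.2 i =ᵐ[volume.restrict Ω] partialDeriv i φ}
  zero_mem' := by
    refine ⟨0, ⟨contDiff_const, HasCompactSupport.zero, by simp [tsupport]⟩, ?_, fun i => ?_⟩
    · exact Lp.coeFn_zero _ _ _
    · refine (Lp.coeFn_zero ℂ 2 (volume.restrict Ω)).trans ?_
      filter_upwards with x
      simp [partialDeriv]
  add_mem' := by
    rintro p p' ⟨φ, hφ, h1, h2⟩ ⟨φ', hφ', h1', h2'⟩
    refine ⟨φ + φ', ⟨hφ.smooth.add hφ'.smooth, hφ.compact.add hφ'.compact,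
      (tsupport_add _ _).trans (Set.union_subset hφ.support hφ'.support)⟩, ?_, fun i => ?_⟩
    · exact (Lp.coeFn_add _ _).trans (h1.add h1')
    · refine (Lp.coeFn_add _ _).trans (((h2 i).add (h2' i)).trans ?_)
      filter_upwards with x
      have e := fderiv_add (hφ.smooth.differentiable (by simp) x)
        (hφ'.smooth.differentiable (by simp) x)
      simp [partialDeriv, e]
  smul_mem' := by
    rintro c p ⟨φ, hφ, h1, h2⟩
    refine ⟨c • φ, ⟨contDiff_const.smul hφ.smooth, hφ.compact.smul_left,
      (closure_mono (Function.support_const_smul_subset c φ)).trans hφ.support⟩, ?_, fun i => ?_⟩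
    · exact (Lp.coeFn_smul _ _).trans (h1.const_smul c)
    · refine (Lp.coeFn_smul _ _).trans (((h2 i).const_smul c).trans ?_)
      filter_upwards with x
      have e := fderiv_const_smul (hφ.smooth.differentiable (by simp) x) c
      simp [partialDeriv, e]

/-- The graph of the gradient on `H¹₀(Ω)`: the closure of `{(φ, ∇φ) : φ ∈ C_c^∞(Ω)}` in
`L² × (L²)ᵈ`, that is, the closure of `C_c^∞(Ω)` in the `H¹` norm. -/
def gradGraph {d : ℕ} (Ω : Set (Space d)) : Submodule ℂ (L2 Ω × L2Vec Ω) :=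
  (testGraph Ω).topologicalClosure

/-- The gradient, as an operator in `L²(Ω)` with domain `H¹₀(Ω)`. -/
def grad {d : ℕ} (Ω : Set (Space d)) : L2 Ω →ₗ.[ℂ] L2Vec Ω := (gradGraph Ω).toLinearPMap

/-- `H¹₀(Ω)`, as a subspace of `L²(Ω)`. -/
def H10 {d : ℕ} (Ω : Set (Space d)) : Submodule ℂ (L2 Ω) := (grad Ω).domain

theorem IsTestFunction.partialDeriv_continuous {d : ℕ} {Ω : Set (Space d)} {φ : Space d → ℂ}
    (h : IsTestFunction Ω φ) (i : Fin d) : Continuous (partialDeriv i φ) :=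
  (h.smooth.continuous_fderiv (by simp)).clm_apply continuous_const

theorem IsTestFunction.partialDeriv_compact {d : ℕ} {Ω : Set (Space d)} {φ : Space d → ℂ}
    (h : IsTestFunction Ω φ) (i : Fin d) : HasCompactSupport (partialDeriv i φ) :=
  h.compact.fderiv_apply ℝ _

/-- Limits of gradients of test functions are determined by the limits of the functions, so that
`grad Ω` is a well defined operator whose graph is `gradGraph Ω`. -/
theorem gradGraph_single {d : ℕ} {Ω : Set (Space d)} (hΩ : IsOpen Ω) (x : L2 Ω × L2Vec Ω)
    (hx : x ∈ gradGraph Ω) (hx0 : x.1 = 0) : x.2 = 0 := by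
  have key : ∀ (ψ : Space d → ℂ), IsTestFunction Ω ψ → ∀ (i : Fin d),
      ∫ y in Ω, ψ y * x.2 i y = 0 := by
    intro ψ hψ i
    have m0 : MemLp (fun y => (starRingEnd ℂ) (ψ y)) 2 (volume.restrict Ω) :=
      (((Complex.continuous_conj.comp hψ.smooth.continuous).memLp_of_hasCompactSupport
        (hψ.compact.comp_left (map_zero _)) (p := 2) (μ := volume)).restrict Ω)
    have m1 : MemLp (fun y => (starRingEnd ℂ) (partialDeriv i ψ y)) 2 (volume.restrict Ω) :=
      (((Complex.continuous_conj.comp (hψ.partialDeriv_continuous i)).memLp_of_hasCompactSupport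
        ((hψ.partialDeriv_compact i).comp_left (map_zero _)) (p := 2) (μ := volume)).restrict Ω)
    have e0 : ∀ g : L2 Ω, inner ℂ (m0.toLp _) g = ∫ y in Ω, ψ y * g y := by
      intro g
      rw [L2.inner_def]
      refine integral_congr_ae ?_
      filter_upwards [m0.coeFn_toLp] with y hy
      simp [hy, mul_comm]
    have e1 : ∀ g : L2 Ω, inner ℂ (m1.toLp _) g = ∫ y in Ω, partialDeriv i ψ y * g y := by
      intro g
      rw [L2.inner_def]
      refine integral_congr_ae ?_
      filter_upwards [m1.coeFn_toLp] with y hy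
      simp [hy, mul_comm]
    have hcl : IsClosed {p : L2 Ω × L2Vec Ω |
        inner ℂ (m0.toLp _) (p.2 i) + inner ℂ (m1.toLp _) p.1 = (0 : ℂ)} := by
      refine isClosed_eq ?_ continuous_const
      fun_prop
    have hsub : (testGraph Ω : Set (L2 Ω × L2Vec Ω)) ⊆ {p : L2 Ω × L2Vec Ω |
        inner ℂ (m0.toLp _) (p.2 i) + inner ℂ (m1.toLp _) p.1 = (0 : ℂ)} := by
      rintro p ⟨φ, hφ, h1, h2⟩
      simp only [Set.mem_ofPred_eq]
      rw [e0, e1]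
      have a0 : ∫ y in Ω, ψ y * p.2 i y = ∫ y, ψ y * partialDeriv i φ y := by
        rw [← setIntegral_eq_integral_of_forall_compl_eq_zero (s := Ω)
          (f := fun y => ψ y * partialDeriv i φ y)]
        · refine integral_congr_ae ?_
          filter_upwards [h2 i] with y hy
          rw [hy]
        · intro y hy
          rw [image_eq_zero_of_notMem_tsupport (fun h => hy (hψ.support h)), zero_mul]
      have hd : ∀ y, y ∉ Ω → partialDeriv i ψ y = 0 := by
        intro y hy
        have : fderiv ℝ ψ y = 0 :=
          image_eq_zero_of_notMem_tsupport
            (fun h => hy (hψ.support (tsupport_fderiv_subset ℝ h)))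
        simp [partialDeriv, this]
      have a1 : ∫ y in Ω, partialDeriv i ψ y * p.1 y = ∫ y, partialDeriv i ψ y * φ y := by
        rw [← setIntegral_eq_integral_of_forall_compl_eq_zero (s := Ω)
          (f := fun y => partialDeriv i ψ y * φ y)]
        · refine integral_congr_ae ?_
          filter_upwards [h1] with y hy
          rw [hy]
        · intro y hy
          rw [hd y hy, zero_mul]
      rw [a0, a1]
      have ibp := integral_mul_fderiv_eq_neg_fderiv_mul_of_integrable
        (μ := (volume : Measure (Space d))) (f := ψ) (g := φ) (v := EuclideanSpace.single i (1 : ℝ)) (𝕜 := ℂ)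
        (((hψ.partialDeriv_continuous i).mul hφ.smooth.continuous).integrable_of_hasCompactSupport
          ((hψ.partialDeriv_compact i).mul_right))
        ((hψ.smooth.continuous.mul (hφ.partialDeriv_continuous i)).integrable_of_hasCompactSupport
          (hψ.compact.mul_right))
        ((hψ.smooth.continuous.mul hφ.smooth.continuous).integrable_of_hasCompactSupport
          (hψ.compact.mul_right))
        (fun y _ => hψ.smooth.differentiable (by simp) y)
        (fun y _ => hφ.smooth.differentiable (by simp) y)
      have ibp' : ∫ y, ψ y * partialDeriv i φ y = -∫ y, partialDeriv i ψ y * φ y := ibp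
      rw [ibp']
      ring
    have hmem := closure_minimal hsub hcl hx
    simp only [Set.mem_ofPred_eq, hx0, inner_zero_right, add_zero] at hmem
    rw [← e0]
    exact hmem
  ext i
  have hloc : LocallyIntegrableOn (fun y => x.2 i y) Ω volume := by
    have h2 : MemLp (fun y => x.2 i y) 2 (volume.restrict Ω) := Lp.memLp (x.2 i)
    have := h2.locallyIntegrable (by norm_num)
    exact locallyIntegrableOn_of_locallyIntegrable_restrict this
  have hz := hΩ.ae_eq_zero_of_integral_contDiff_smul_eq_zero hloc (by
    intro g hg hgc hgs
    have hsup : tsupport (fun y => ((g y : ℝ) : ℂ)) ⊆ Ω :=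
      (closure_mono (fun y hy => by simpa using hy)).trans hgs
    have := key (fun y => (g y : ℂ)) ⟨Complex.ofRealCLM.contDiff.comp hg,
      hgc.comp_left (g := fun t : ℝ => (t : ℂ)) (by simp), hsup⟩ i
    rw [setIntegral_eq_integral_of_forall_compl_eq_zero] at this
    · simpa using this
    · intro y hy
      rw [image_eq_zero_of_notMem_tsupport (f := fun y => ((g y : ℝ) : ℂ))
        (fun h => hy (hsup h)), zero_mul])
  have hz' : (fun y => x.2 i y) =ᵐ[volume.restrict Ω] 0 :=
    (ae_restrict_iff' hΩ.measurableSet).2 hz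
  refine hz'.trans ?_
  exact (Lp.coeFn_zero ℂ 2 (volume.restrict Ω)).symm

/-- `u ∈ H¹₀(Ω)` has gradient `g` exactly if `(u, g)` is a limit of pairs `(φ, ∇φ)`. -/
theorem grad_eq_iff {d : ℕ} {Ω : Set (Space d)} (hΩ : IsOpen Ω) (u : L2 Ω) (g : L2Vec Ω) :
    (u, g) ∈ gradGraph Ω ↔ ∃ h : u ∈ H10 Ω, grad Ω ⟨u, h⟩ = g := by
  have e := Submodule.toLinearPMap_graph_eq (gradGraph Ω) (gradGraph_single hΩ)
  rw [← e, LinearPMap.mem_graph_iff]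
  constructor
  · rintro ⟨y, rfl, rfl⟩
    exact ⟨y.2, rfl⟩
  · rintro ⟨h, rfl⟩
    exact ⟨⟨u, h⟩, rfl, rfl⟩

/-! ### Finite element spaces -/

/-- The two reference cells. -/
inductive RefShape
  | simplex
  | cube

/-- The reference simplex `{y ≥ 0, ∑ yᵢ ≤ 1}`, respectively the reference cube `[0,1]ᵈ`. -/
def RefShape.domain (d : ℕ) : RefShape → Set (Space d)
  | .simplex => {y | (∀ i, 0 ≤ y i) ∧ ∑ i, y i ≤ 1}
  | .cube => {y | ∀ i, 0 ≤ y i ∧ y i ≤ 1}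

/-- Components of maps of a reference cell: affine for the simplex, multilinear (`Q₁`) for the
cube. -/
def RefShape.mapPolys (d : ℕ) : RefShape → Submodule ℝ (MvPolynomial (Fin d) ℝ)
  | .simplex => MvPolynomial.restrictTotalDegree (Fin d) ℝ 1
  | .cube => MvPolynomial.restrictDegree (Fin d) ℝ 1

/-- The map `ℝᵈ → ℝᵈ` with the given polynomial components. -/
def polyMap {d : ℕ} (F : Fin d → MvPolynomial (Fin d) ℝ) (y : Space d) : Space d :=
  WithLp.toLp 2 (fun i => MvPolynomial.eval (fun j => y j) (F i))

/-- The type of local polynomial space on a cell: `P_r` or `Q_r`. -/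
inductive PolyKind
  | P
  | Q

/-- `P_r`: total degree at most `r`; `Q_r`: degree at most `r` in each variable. -/
def PolyKind.space (d r : ℕ) : PolyKind → Submodule ℂ (MvPolynomial (Fin d) ℂ)
  | .P => MvPolynomial.restrictTotalDegree (Fin d) ℂ r
  | .Q => MvPolynomial.restrictDegree (Fin d) ℂ r

/-- The variable in which the functions of the local space are polynomials: the physical variable
`x`, or the variable of the reference cell (the usual mapped elements on quadrilaterals and
hexahedra). For cells that are affine images of their reference cell the two agree for `P_r`. -/
inductive CoordKind
  | physical
  | reference

/-- A finite element cell: a triangle or tetrahedron (injective affine image of the reference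
simplex) or a quadrilateral or hexahedron (injective multilinear image of the reference cube),
together with the kind of polynomial space that is used on it. -/
structure Cell (d : ℕ) where
  shape : RefShape
  map : Fin d → MvPolynomial (Fin d) ℝ
  map_mem : ∀ i, map i ∈ shape.mapPolys d
  injOn : Set.InjOn (polyMap map) (shape.domain d)
  kind : PolyKind
  coord : CoordKind

/-- The closed cell in `ℝᵈ`. -/
def Cell.carrier {d : ℕ} (K : Cell d) : Set (Space d) := polyMap K.map '' K.shape.domain d

/-- The value at the point `x = F(y)` of the function on the cell given by the polynomial `p`. -/
def Cell.evalAt {d : ℕ} (K : Cell d) (p : MvPolynomial (Fin d) ℂ) (x y : Space d) : ℂ :=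
  match K.coord with
  | .physical => MvPolynomial.eval (fun j => ((x j : ℝ) : ℂ)) p
  | .reference => MvPolynomial.eval (fun j => ((y j : ℝ) : ℂ)) p

/-- `u` restricted to the cell `K` is (almost everywhere) the function given by `p`. -/
def Cell.IsRestriction {d : ℕ} (K : Cell d) (Ω : Set (Space d)) (u : L2 Ω)
    (p : MvPolynomial (Fin d) ℂ) : Prop :=
  ∀ᵐ x ∂(volume.restrict Ω), ∀ y ∈ K.shape.domain d, polyMap K.map y = x → u x = K.evalAt p x y

/-- A partition of `Ω` into finitely many cells; no quasi-uniformity, shape regularity or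
conformity is required. -/
structure Mesh {d : ℕ} (Ω : Set (Space d)) where
  size : ℕ
  cell : Fin size → Cell d
  cover : ⋃ i, (cell i).carrier = closure Ω
  disjoint : Pairwise fun i j => Disjoint (interior (cell i).carrier) (interior (cell j).carrier)

theorem Cell.evalAt_zero {d : ℕ} (K : Cell d) (x y : Space d) : K.evalAt 0 x y = 0 := by
  unfold Cell.evalAt; split <;> simp

theorem Cell.evalAt_add {d : ℕ} (K : Cell d) (p p' : MvPolynomial (Fin d) ℂ) (x y : Space d) :
    K.evalAt (p + p') x y = K.evalAt p x y + K.evalAt p' x y := by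
  unfold Cell.evalAt; split <;> simp

theorem Cell.evalAt_smul {d : ℕ} (K : Cell d) (c : ℂ) (p : MvPolynomial (Fin d) ℂ)
    (x y : Space d) : K.evalAt (c • p) x y = c * K.evalAt p x y := by
  unfold Cell.evalAt; split <;> simp [MvPolynomial.smul_eval]

theorem Cell.IsRestriction.zero {d : ℕ} (K : Cell d) (Ω : Set (Space d)) :
    K.IsRestriction Ω 0 0 := by
  filter_upwards [Lp.coeFn_zero ℂ 2 (volume.restrict Ω)] with x hx y _ _
  rw [K.evalAt_zero]
  exact hx

theorem Cell.IsRestriction.add {d : ℕ} {K : Cell d} {Ω : Set (Space d)} {u u' : L2 Ω}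
    {p p' : MvPolynomial (Fin d) ℂ} (h : K.IsRestriction Ω u p) (h' : K.IsRestriction Ω u' p') :
    K.IsRestriction Ω (u + u') (p + p') := by
  filter_upwards [h, h', Lp.coeFn_add u u'] with x h1 h2 h3 y hy hx
  rw [h3, Pi.add_apply, h1 y hy hx, h2 y hy hx, K.evalAt_add]

theorem Cell.IsRestriction.smul {d : ℕ} {K : Cell d} {Ω : Set (Space d)} {u : L2 Ω}
    {p : MvPolynomial (Fin d) ℂ} (c : ℂ) (h : K.IsRestriction Ω u p) :
    K.IsRestriction Ω (c • u) (c • p) := by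
  filter_upwards [h, Lp.coeFn_smul c u] with x h1 h3 y hy hx
  rw [h3, Pi.smul_apply, h1 y hy hx, K.evalAt_smul, smul_eq_mul]

/-- The finite element space `V_h` of degree `r`: all functions in `H¹₀(Ω)` that belong to the
local polynomial space on each cell. -/
def feSpace {d : ℕ} {Ω : Set (Space d)} (𝒯 : Mesh Ω) (r : ℕ) : Submodule ℂ (L2 Ω) where
  carrier := {u | u ∈ H10 Ω ∧ ∀ i, ∃ p ∈ (𝒯.cell i).kind.space d r,
    (𝒯.cell i).IsRestriction Ω u p}
  zero_mem' := ⟨zero_mem _, fun _ => ⟨0, zero_mem _, .zero _ _⟩⟩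
  add_mem' := by
    rintro u u' ⟨h, hp⟩ ⟨h', hp'⟩
    refine ⟨add_mem h h', fun i => ?_⟩
    obtain ⟨p, hp1, hp2⟩ := hp i
    obtain ⟨p', hp1', hp2'⟩ := hp' i
    exact ⟨p + p', add_mem hp1 hp1', hp2.add hp2'⟩
  smul_mem' := by
    rintro c u ⟨h, hp⟩
    refine ⟨Submodule.smul_mem _ c h, fun i => ?_⟩
    obtain ⟨p, hp1, hp2⟩ := hp i
    exact ⟨c • p, Submodule.smul_mem _ c hp1, hp2.smul c⟩

theorem feSpace_le {d : ℕ} {Ω : Set (Space d)} (𝒯 : Mesh Ω) (r : ℕ) : feSpace 𝒯 r ≤ H10 Ω :=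
  fun _ h => h.1

instance PolyKind.space_finite (d r : ℕ) (k : PolyKind) : Module.Finite ℂ (k.space d r) := by
  cases k <;> unfold PolyKind.space <;> infer_instance

instance feSpace_finiteDimensional {d : ℕ} {Ω : Set (Space d)} (𝒯 : Mesh Ω) (r : ℕ) :
    FiniteDimensional ℂ (feSpace 𝒯 r) := by
  let R : Submodule ℂ ((∀ i, (𝒯.cell i).kind.space d r) × feSpace 𝒯 r) :=
    { carrier := {w | ∀ i, (𝒯.cell i).IsRestriction Ω (w.2 : L2 Ω) (w.1 i)}
      zero_mem' := fun i => .zero _ _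
      add_mem' := fun h h' i => (h i).add (h' i)
      smul_mem' := fun c _ h i => (h i).smul c }
  have h1 : Function.Injective ((LinearMap.fst ℂ _ _).comp R.subtype) := by
    refine (injective_iff_map_eq_zero _).2 ?_
    rintro ⟨⟨w, u⟩, hw⟩ h0
    have hw0 : w = 0 := h0
    subst hw0
    have hu : (u : L2 Ω) = 0 := by
      ext
      have hall : ∀ᵐ x ∂(volume.restrict Ω), ∀ i, ∀ y ∈ (𝒯.cell i).shape.domain d,
          polyMap (𝒯.cell i).map y = x → (u : L2 Ω) x = (𝒯.cell i).evalAt 0 x y :=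
        ae_all_iff.2 fun i => hw i
      have hmem : ∀ᵐ x ∂(volume.restrict Ω), x ∈ closure Ω :=
        ae_mono (Measure.restrict_mono subset_closure le_rfl)
          (ae_restrict_mem isClosed_closure.measurableSet)
      filter_upwards [hall, hmem, Lp.coeFn_zero ℂ 2 (volume.restrict Ω)] with x hx hxm hz
      rw [hz, Pi.zero_apply]
      rw [← 𝒯.cover, Set.mem_iUnion] at hxm
      obtain ⟨i, y, hy, hyx⟩ := hxm
      rw [hx i y hy hyx, Cell.evalAt_zero]
    have hu' : u = 0 := Subtype.ext hu
    subst hu'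
    rfl
  have : Module.Finite ℂ R := Module.Finite.of_injective _ h1
  refine Module.Finite.of_surjective ((LinearMap.snd ℂ _ _).comp R.subtype) fun u => ?_
  choose p hp hpu using u.2.2
  exact ⟨⟨⟨fun i => ⟨p i, hp i⟩, u⟩, hpu⟩, rfl⟩

/-! ### Discrete operators -/

/-- The gradient on a subspace `V` of `H¹₀(Ω)`. -/
def gradOn {d : ℕ} {Ω : Set (Space d)} {V : Submodule ℂ (L2 Ω)} (hV : V ≤ H10 Ω) :
    V →ₗ[ℂ] L2Vec Ω :=
  (grad Ω).toFun ∘ₗ Submodule.inclusion hV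

/-- The Dirichlet form `(∇u, ∇v)_Ω = ∑ᵢ ∫_Ω ∂ᵢu · conj(∂ᵢv)` on `V ⊆ H¹₀(Ω)`. -/
def dirichlet {d : ℕ} {Ω : Set (Space d)} {V : Submodule ℂ (L2 Ω)} (hV : V ≤ H10 Ω)
    (u v : V) : ℂ :=
  inner ℂ (gradOn hV v) (gradOn hV u)

/-- The discrete Laplacian `Δ_h = -(∇|_V)^* ∇|_V` on a finite dimensional `V ⊆ H¹₀(Ω)`. -/
def discreteLaplacian {d : ℕ} {Ω : Set (Space d)} {V : Submodule ℂ (L2 Ω)}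
    [FiniteDimensional ℂ V] (hV : V ≤ H10 Ω) : Module.End ℂ V :=
  haveI : CompleteSpace V := FiniteDimensional.complete ℂ V;
  -((ContinuousLinearMap.adjoint (LinearMap.toContinuousLinearMap (gradOn hV))).toLinearMap ∘ₗ
    gradOn hV)

/-- `Δ_h` is the operator on `V` determined by `(-Δ_h v, χ)_Ω = (∇v, ∇χ)_Ω` for all `χ ∈ V`. -/
theorem discreteLaplacian_eq_iff {d : ℕ} {Ω : Set (Space d)} {V : Submodule ℂ (L2 Ω)}
    [FiniteDimensional ℂ V] (hV : V ≤ H10 Ω) (v w : V) :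
    discreteLaplacian hV v = w ↔ ∀ χ : V, inner ℂ χ (-w) = dirichlet hV v χ := by
  have : CompleteSpace V := FiniteDimensional.complete ℂ V
  have h : ∀ χ : V, inner ℂ χ (-discreteLaplacian hV v) = dirichlet hV v χ := by
    intro χ
    simp only [discreteLaplacian, LinearMap.neg_apply, neg_neg, LinearMap.comp_apply]
    exact ContinuousLinearMap.adjoint_inner_right _ _ _
  constructor
  · rintro rfl
    exact h
  · intro h'
    refine neg_injective (ext_inner_left ℂ fun χ => ?_)
    rw [h, h']

/-! ### Time discretization -/

/-- A partition `0 = t₀ < t₁ < ⋯ < t_M = T`. -/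
structure TimeMesh (T : ℝ) (M : ℕ) where
  node : ℕ → ℝ
  node_zero : node 0 = 0
  node_last : node M = T
  node_lt : ∀ m < M, node m < node (m + 1)

/-- `I_m = (t_{m-1}, t_m]`, for `1 ≤ m ≤ M`. -/
def TimeMesh.interval {T : ℝ} {M : ℕ} (τ : TimeMesh T M) (m : ℕ) : Set ℝ :=
  Set.Ioc (τ.node (m - 1)) (τ.node m)

/-- `k_m = t_m - t_{m-1}`, for `1 ≤ m ≤ M`. -/
def TimeMesh.step {T : ℝ} {M : ℕ} (τ : TimeMesh T M) (m : ℕ) : ℝ :=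
  τ.node m - τ.node (m - 1)

/-- `κ⁻¹ ≤ k_m / k_{m+1} ≤ κ` for `1 ≤ m ≤ M - 1`. -/
def TimeMesh.RatioBounded {T : ℝ} {M : ℕ} (τ : TimeMesh T M) (κ : ℝ) : Prop :=
  ∀ m, 1 ≤ m → m < M → κ⁻¹ ≤ τ.step m / τ.step (m + 1) ∧ τ.step m / τ.step (m + 1) ≤ κ

/-- The space `X_{kh}`: on each `I_m` a polynomial in time of degree at most `q` with coefficients
in `V`. -/
def IsPiecewisePoly {T : ℝ} {M : ℕ} (τ : TimeMesh T M) (q : ℕ) {V : Type*} [AddCommGroup V]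
    [Module ℂ V] (u : ℝ → V) : Prop :=
  ∀ m ∈ Finset.Icc 1 M, ∃ c : ℕ → V, ∀ t ∈ τ.interval m,
    u t = ∑ j ∈ Finset.range (q + 1), ((t : ℂ) ^ j) • c j

/-- `u^+(s) = lim_{ε → 0+} u(s + ε)`. -/
def rightLim {V : Type*} [TopologicalSpace V] [Nonempty V] (u : ℝ → V) (s : ℝ) : V :=
  limUnder (𝓝[>] s) u

/-- `u^-(s) = lim_{ε → 0+} u(s - ε)`. -/
def leftLim {V : Type*} [TopologicalSpace V] [Nonempty V] (u : ℝ → V) (s : ℝ) : V :=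
  limUnder (𝓝[<] s) u

/-- The time derivative on `I_m` (one-sided at the right end point `t_m`). -/
def TimeMesh.timeDeriv {T : ℝ} {M : ℕ} (τ : TimeMesh T M) (m : ℕ) {V : Type*}
    [NormedAddCommGroup V] [NormedSpace ℂ V] (u : ℝ → V) (t : ℝ) : V :=
  letI : NormedSpace ℝ V := NormedSpace.complexToReal
  derivWithin u (τ.interval m) t

/-- The form `B(u, φ)`, linear in `u` and conjugate linear in `φ`; the inner product of `V` is that
of `L²(Ω)`. -/
def formB {d : ℕ} {Ω : Set (Space d)} {V : Submodule ℂ (L2 Ω)} (hV : V ≤ H10 Ω)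
    {T : ℝ} {M : ℕ} (τ : TimeMesh T M) (u φ : ℝ → V) : ℂ :=
  (∑ m ∈ Finset.Icc 1 M, ∫ t in τ.interval m, inner ℂ (φ t) (τ.timeDeriv m u t))
    + (∫ t in Set.Ioo 0 T, dirichlet hV (u t) (φ t))
    + (∑ m ∈ Finset.Icc 2 M, inner ℂ (rightLim φ (τ.node (m - 1)))
        (rightLim u (τ.node (m - 1)) - leftLim u (τ.node (m - 1))))
    + inner ℂ (rightLim φ 0) (rightLim u 0)

/-- `u ∈ X_{kh}` solves `B(u, φ) = (u₀, φ_0^+)_Ω` for all `φ ∈ X_{kh}`. -/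
def IsHomogeneousSolution {d : ℕ} {Ω : Set (Space d)} {V : Submodule ℂ (L2 Ω)} (hV : V ≤ H10 Ω)
    {T : ℝ} {M : ℕ} (τ : TimeMesh T M) (q : ℕ) (u₀ : L2 Ω) (u : ℝ → V) : Prop :=
  IsPiecewisePoly τ q u ∧ ∀ φ : ℝ → V, IsPiecewisePoly τ q φ →
    formB hV τ u φ = inner ℂ ((rightLim φ 0 : V) : L2 Ω) u₀

/-- The `L²(Ω)`-orthogonal projection onto `V`. -/
def l2Proj {d : ℕ} {Ω : Set (Space d)} (V : Submodule ℂ (L2 Ω)) [FiniteDimensional ℂ V]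
    (v : L2 Ω) : V :=
  V.orthogonalProjectionOnto v

/-- The jump `[u]_{m-1}` for `m ≥ 1`, where the value before `t₀ = 0` is `P_h u₀`. -/
def jump {d : ℕ} {Ω : Set (Space d)} {V : Submodule ℂ (L2 Ω)} [FiniteDimensional ℂ V]
    {T : ℝ} {M : ℕ} (τ : TimeMesh T M) (u₀ : L2 Ω) (u : ℝ → V) (m : ℕ) : V :=
  if m = 1 then rightLim u 0 - l2Proj V u₀
  else rightLim u (τ.node (m - 1)) - leftLim u (τ.node (m - 1))

/-- The sector `Σ_γ = {z : |arg z| ≤ γ}`. -/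
def sector (γ : ℝ) : Set ℂ := {z | |z.arg| ≤ γ}

/-- The resolvent estimate `⦀(z + Δ_h)⁻¹ χ⦀ ≤ (M_h / |z|) ⦀χ⦀` for `z ∉ Σ_γ`. Here
`resolvent a z = (z - a)⁻¹`. -/
def ResolventEstimate {V : Type*} [AddCommGroup V] [Module ℂ V] (Δh : Module.End ℂ V)
    (γ : ℝ) (N : Seminorm ℂ V) (Mh : ℝ) : Prop :=
  ∀ z : ℂ, z ∉ sector γ → ∀ χ : V, N (resolvent (-Δh) z χ) ≤ Mh / ‖z‖ * N χ

end DGFE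

end

open DGFE

/-! ### Rays, sectors and Cauchy's formula on the boundary of a sector -/

/-! The operator `-Δ_h` is symmetric and nonnegative, so it has an orthonormal eigenbasis, and in
eigencoordinates the scheme splits into scalar dG problems. After rescaling an interval to `[0,1]`,
each scalar problem depends only on `μ = k_m λ`. Its solution with initial value 1 is `step q μ = (μ
+ S)⁻¹ ℓ`, where `S` is a fixed operator on polynomials of degree at most `q` and `ℓ` represents
evaluation at 0. With the amplification factor `r(μ) = ev 1 (step q μ)`, the solution on `I_m` is
`step(k_m λ) r(k_{m-1} λ) ⋯ r(k_1 λ)` applied to `P_h u₀`. The three quantities to be estimated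
reduce to functions `F(-Δ_h) P_h u₀` with `F(z) = z L(step(k_m z)) ∏_{j<m} r(k_j z)` and `L` a
linear functional on polynomials: for the jump `L` is the leading coefficient, for `Δ_h u` it is a
point evaluation, and `∂_t u` is a combination of these two by the strong form of the scheme.

Let `γ < θ < π/2`. Cauchy's formula on the rays `arg z = ±θ` writes `F(-Δ_h) v` as an integral of
`F(z) z (z + Δ_h)⁻¹ v` against `d|z|/|z|`, and the resolvent estimate bounds `|||z (z + Δ_h)⁻¹ v|||`
by `M_h |||v|||`. If `|F(z)| ≤ B s / (1 + a² s²)` with `s = |z|`, the remaining integral is `B ∫ ds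
/ (1 + a² s²) = B π / (2a)`, and `a` proportional to `t_m` gives the factor `1/t_m`. This is
`norm_sum_apply_le_of_sectorDecay`, which rests on `SectorDecay.integral_kernel`.

The decay of `F` comes from `‖step q μ‖ ≤ C / (1 + |μ|)` and `|r(μ)| ≤ 1 / (1 + c|μ|)` in the
sector. Constant 1 in the numerator of the second bound is essential, since the factors are
multiplied over arbitrarily many steps; it follows from the energy identity for small `μ` and from
resolvent decay for large `μ`. For `m ≥ 2` the ratio condition prevents a single step from
dominating `t_m`, so `∏ (1 + y k_j) ≥ 1 + (y t_m)² / (2(1 + κ))`, which is the required quadratic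
decay.

For `m = 1` there is only one decaying factor, so `F` need not decay. Subtracting `L(ℓ) z / (1 + k_1
z)` restores the decay, and the subtracted term is a multiple of `k_1⁻¹ (1 - (1 - k_1 Δ_h)⁻¹)`,
controlled by the resolvent at the single point `-1/k_1`. -/

/-- The point `exp (x + iθ)` of the ray with angle `θ`. -/
noncomputable def rayPoint (θ x : ℝ) : ℂ := Complex.exp (x + θ * Complex.I)

/-- The closed sector of half opening angle `θ` around the positive real axis. -/
def closedSector (θ : ℝ) : Set ℂ := {z | Real.cos θ * ‖z‖ ≤ z.re}

theorem norm_rayPoint (θ x : ℝ) : ‖rayPoint θ x‖ = Real.exp x := by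
  simp [rayPoint, Complex.norm_exp]

theorem rayPoint_re (θ x : ℝ) : (rayPoint θ x).re = Real.exp x * Real.cos θ := by
  simp [rayPoint, Complex.exp_re]

theorem rayPoint_im (θ x : ℝ) : (rayPoint θ x).im = Real.exp x * Real.sin θ := by
  simp [rayPoint, Complex.exp_im]

theorem rayPoint_ne_zero (θ x : ℝ) : rayPoint θ x ≠ 0 := Complex.exp_ne_zero _

theorem hasDerivAt_rayPoint (θ x : ℝ) : HasDerivAt (rayPoint θ) (rayPoint θ x) x := by
  have h : HasDerivAt (fun y : ℝ => ((y : ℂ) + θ * Complex.I)) 1 x :=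
    (Complex.ofRealCLM.hasDerivAt (x := x)).add_const _
  have := h.cexp
  rw [mul_one] at this
  exact this

theorem continuous_rayPoint (θ : ℝ) : Continuous (rayPoint θ) := by
  unfold rayPoint; fun_prop

theorem rayPoint_re_pos {θ : ℝ} (hθ : |θ| < Real.pi / 2) (x : ℝ) : 0 < (rayPoint θ x).re := by
  rw [rayPoint_re]
  exact mul_pos (Real.exp_pos _) (Real.cos_pos_of_mem_Ioo ⟨(abs_lt.1 hθ).1, (abs_lt.1 hθ).2⟩)

theorem rayPoint_mem_closedSector {θ y : ℝ} (hθ : θ < Real.pi / 2) (hy : |y| ≤ θ) (x : ℝ) :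
    rayPoint y x ∈ closedSector θ := by
  have hc : Real.cos θ ≤ Real.cos y := by
    rw [← Real.cos_abs y]
    exact Real.cos_le_cos_of_nonneg_of_le_pi (abs_nonneg _) (by linarith [Real.pi_pos]) hy
  have := Real.exp_pos x
  simp only [closedSector, Set.mem_ofPred_eq, norm_rayPoint, rayPoint_re]
  nlinarith

theorem ofReal_mem_closedSector (θ : ℝ) {s : ℝ} (hs : 0 ≤ s) : (s : ℂ) ∈ closedSector θ := by
  simp only [closedSector, Set.mem_ofPred_eq, Complex.norm_real, Real.norm_eq_abs,
    abs_of_nonneg hs, Complex.ofReal_re]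
  nlinarith [Real.cos_le_one θ]

theorem re_pos_of_mem_closedSector {θ : ℝ} (hθ : |θ| < Real.pi / 2) {z : ℂ}
    (hz : z ∈ closedSector θ) (h0 : z ≠ 0) : 0 < z.re := by
  have hc := Real.cos_pos_of_mem_Ioo ⟨(abs_lt.1 hθ).1, (abs_lt.1 hθ).2⟩
  exact lt_of_lt_of_le (mul_pos hc (norm_pos_iff.2 h0)) hz

/-- This makes the resolvent estimate available on the contour: rays with angle strictly between `γ`
and `π/2` in absolute value avoid `sector γ`, which is described by the argument and not by the
cosine. -/
theorem rayPoint_notMem_sector {γ θ : ℝ} (h0 : γ < |θ|) (hθ : |θ| < Real.pi / 2) (x : ℝ) :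
    rayPoint θ x ∉ sector γ := by
  have e : (rayPoint θ x).arg = θ := by
    unfold rayPoint
    rw [Complex.exp_add, ← Complex.ofReal_exp, Complex.arg_real_mul _ (Real.exp_pos _),
      Complex.arg_exp_mul_I, toIocMod_eq_self]
    have := abs_lt.1 hθ
    constructor <;> linarith [Real.pi_pos]
  simp only [sector, Set.mem_ofPred_eq, e]
  linarith

theorem sq_norm_rayPoint_sub (θ x l : ℝ) :
    ‖rayPoint θ x - l‖ ^ 2 = Real.exp x ^ 2 - 2 * Real.exp x * l * Real.cos θ + l ^ 2 := by
  rw [← Complex.normSq_eq_norm_sq, Complex.normSq_apply]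
  simp only [Complex.sub_re, Complex.sub_im, Complex.ofReal_re, Complex.ofReal_im,
    rayPoint_re, rayPoint_im]
  linear_combination (Real.exp x ^ 2) * Real.sin_sq_add_cos_sq θ

/-- Distance from the ray point to the real axis, by completing the square in `l`. It bounds the
Cauchy kernel `|z| / |z - l|` by `1 / |sin θ|` uniformly in `l`. -/
theorem abs_sin_mul_exp_le_norm_sub (θ x l : ℝ) :
    |Real.sin θ| * Real.exp x ≤ ‖rayPoint θ x - l‖ := by
  refine abs_le_of_sq_le_sq' ?_ (norm_nonneg _) |>.2
  rw [sq_norm_rayPoint_sub, mul_pow, sq_abs]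
  nlinarith [sq_nonneg (l - Real.exp x * Real.cos θ), Real.sin_sq_add_cos_sq θ]

/-- The same square completed in the other variable: the distance from `l` to the line spanned by
the ray. -/
theorem abs_sin_mul_le_norm_sub (θ x l : ℝ) :
    |Real.sin θ| * l ≤ ‖rayPoint θ x - l‖ := by
  refine abs_le_of_sq_le_sq' ?_ (norm_nonneg _) |>.2
  rw [sq_norm_rayPoint_sub, mul_pow, sq_abs]
  nlinarith [sq_nonneg (Real.exp x - l * Real.cos θ), Real.sin_sq_add_cos_sq θ]

theorem norm_le_norm_ofReal_add {z : ℂ} (hz : 0 ≤ z.re) {l : ℝ} (hl : 0 ≤ l) :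
    ‖z‖ ≤ ‖(l : ℂ) + z‖ ∧ l ≤ ‖(l : ℂ) + z‖ := by
  constructor
  · refine abs_le_of_sq_le_sq' ?_ (norm_nonneg _) |>.2
    rw [← Complex.normSq_eq_norm_sq, ← Complex.normSq_eq_norm_sq, Complex.normSq_apply,
      Complex.normSq_apply]
    simp only [Complex.add_re, Complex.ofReal_re, Complex.add_im, Complex.ofReal_im]
    nlinarith [mul_nonneg hz hl]
  · refine le_trans ?_ (Complex.re_le_norm _)
    simp only [Complex.add_re, Complex.ofReal_re]
    linarith

/-- The weight `s / (1 + a² s²)` at `s = exp x`. -/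
noncomputable def expWeight (a x : ℝ) : ℝ := Real.exp x / (1 + (a * Real.exp x) ^ 2)

theorem expWeight_nonneg (a x : ℝ) : 0 ≤ expWeight a x := by unfold expWeight; positivity

theorem hasDerivAt_arctan_exp {a : ℝ} (ha : 0 < a) (x : ℝ) :
    HasDerivAt (fun x => a⁻¹ * Real.arctan (a * Real.exp x)) (expWeight a x) x := by
  have h := (((Real.hasDerivAt_exp x).const_mul a).arctan).const_mul a⁻¹
  refine h.congr_deriv ?_
  unfold expWeight
  field_simp

theorem tendsto_arctan_exp_atTop {a : ℝ} (ha : 0 < a) :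
    Tendsto (fun x => a⁻¹ * Real.arctan (a * Real.exp x)) atTop (𝓝 (a⁻¹ * (Real.pi / 2))) := by
  refine Tendsto.const_mul _ ?_
  refine (tendsto_nhds_of_tendsto_nhdsWithin Real.tendsto_arctan_atTop).comp ?_
  exact Real.tendsto_exp_atTop.const_mul_atTop ha

theorem tendsto_arctan_exp_atBot (a : ℝ) :
    Tendsto (fun x => a⁻¹ * Real.arctan (a * Real.exp x)) atBot (𝓝 0) := by
  have h : Tendsto (fun s : ℝ => a⁻¹ * Real.arctan (a * s)) (𝓝 0) (𝓝 (a⁻¹ * Real.arctan (a * 0))) :=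
    Continuous.tendsto (by fun_prop) 0
  simp only [mul_zero, Real.arctan_zero] at h
  exact h.comp Real.tendsto_exp_atBot

theorem continuous_expWeight (a : ℝ) : Continuous (expWeight a) := by
  unfold expWeight
  refine Real.continuous_exp.div (by fun_prop) fun x => by positivity

theorem integrable_expWeight {a : ℝ} (ha : 0 < a) : Integrable (expWeight a) := by
  refine integrable_of_intervalIntegral_norm_tendsto (ι := ℕ) (l := atTop)
    (a := fun n => -(n : ℝ)) (b := fun n => (n : ℝ)) (a⁻¹ * (Real.pi / 2) - 0)
    (fun n => ((continuous_expWeight a).integrableOn_Icc).mono_set Set.Ioc_subset_Icc_self)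
    (tendsto_neg_atTop_atBot.comp tendsto_natCast_atTop_atTop) tendsto_natCast_atTop_atTop ?_
  have e : ∀ n : ℕ, ∫ x in (-(n : ℝ))..n, ‖expWeight a x‖ =
      a⁻¹ * Real.arctan (a * Real.exp n) - a⁻¹ * Real.arctan (a * Real.exp (-(n : ℝ))) := by
    intro n
    simp_rw [Real.norm_of_nonneg (expWeight_nonneg a _)]
    exact intervalIntegral.integral_eq_sub_of_hasDerivAt (fun x _ => hasDerivAt_arctan_exp ha x)
      ((continuous_expWeight a).intervalIntegrable _ _)
  simp_rw [e]
  exact ((tendsto_arctan_exp_atTop ha).comp tendsto_natCast_atTop_atTop).sub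
    ((tendsto_arctan_exp_atBot a).comp (tendsto_neg_atTop_atBot.comp tendsto_natCast_atTop_atTop))

/-- In the variable `s = exp x` this is `∫ ds / (1 + a² s²)` over the half line. The factor `1/a`
becomes `1/t_m` in the smoothing estimate. -/
theorem integral_expWeight {a : ℝ} (ha : 0 < a) : ∫ x, expWeight a x = a⁻¹ * (Real.pi / 2) := by
  rw [integral_of_hasDerivAt_of_tendsto (hasDerivAt_arctan_exp ha) (integrable_expWeight ha)
    (tendsto_arctan_exp_atBot a) (tendsto_arctan_exp_atTop ha), sub_zero]

/-- Cauchy's theorem for a sector: integrals over the two boundary rays agree. -/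
theorem integral_rayPoint_eq {f : ℂ → ℂ} {θ : ℝ} (h0 : 0 ≤ θ) (hθ : θ < Real.pi / 2)
    (hf : DifferentiableOn ℂ f {z | 0 < z.re})
    (hp : Integrable fun x => f (rayPoint θ x) * rayPoint θ x)
    (hm : Integrable fun x => f (rayPoint (-θ) x) * rayPoint (-θ) x) {C X : ℝ}
    (hC : ∀ x y : ℝ, |y| ≤ θ → X ≤ |x| → ‖f (rayPoint y x) * rayPoint y x‖ ≤ C * Real.exp (-|x|)) :
    ∫ x, f (rayPoint θ x) * rayPoint θ x = ∫ x, f (rayPoint (-θ) x) * rayPoint (-θ) x := by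
  -- Logarithmic coordinates turn the sector into the strip `|Im w| ≤ θ`, so Cauchy's theorem is
  -- applied to the rectangle `[-R, R] × [-θ, θ]`; its horizontal sides are the truncated rays.
  set h : ℂ → ℂ := fun w => f (Complex.exp w) * Complex.exp w with hdef
  have key : ∀ R : ℝ, (∫ x in (-R)..R, f (rayPoint (-θ) x) * rayPoint (-θ) x)
      - (∫ x in (-R)..R, f (rayPoint θ x) * rayPoint θ x)
      = Complex.I * (∫ y in (-θ)..θ, f (rayPoint y (-R)) * rayPoint y (-R))
      - Complex.I * (∫ y in (-θ)..θ, f (rayPoint y R) * rayPoint y R) := by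
    intro R
    have hd : DifferentiableOn ℂ h (Set.uIcc (⟨-R, -θ⟩ : ℂ).re (⟨R, θ⟩ : ℂ).re ×ℂ
        Set.uIcc (⟨-R, -θ⟩ : ℂ).im (⟨R, θ⟩ : ℂ).im) := by
      refine DifferentiableOn.mul ?_ Complex.differentiable_exp.differentiableOn
      refine hf.comp Complex.differentiable_exp.differentiableOn ?_
      intro w hw
      have hw2 := hw.2
      simp only [Set.mem_preimage, Set.uIcc_of_le (show -θ ≤ θ by linarith), Set.mem_Icc] at hw2
      simp only [Set.mem_ofPred_eq, Complex.exp_re]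
      refine mul_pos (Real.exp_pos _) (Real.cos_pos_of_mem_Ioo ⟨?_, ?_⟩) <;> linarith [hw2.1, hw2.2]
    have := Complex.integral_boundary_rect_eq_zero_of_differentiableOn h ⟨-R, -θ⟩ ⟨R, θ⟩ hd
    simp only [hdef, smul_eq_mul] at this
    simp only [rayPoint]
    linear_combination this
  -- The vertical sides are arcs of radius `exp (±R)`; hypothesis `hC` makes their contribution
  -- `O(exp (-R))`.
  have hvert : ∀ R : ℝ, X ≤ R → 0 ≤ R →
      ‖Complex.I * (∫ y in (-θ)..θ, f (rayPoint y (-R)) * rayPoint y (-R))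
      - Complex.I * (∫ y in (-θ)..θ, f (rayPoint y R) * rayPoint y R)‖ ≤
      2 * (C * (2 * θ)) * Real.exp (-R) := by
    intro R hR hR0
    have hh : ∀ R' : ℝ, |R'| = R →
        ‖∫ y in (-θ)..θ, f (rayPoint y R') * rayPoint y R'‖ ≤ C * Real.exp (-R) * (2 * θ) := by
      intro R' hR'
      have := intervalIntegral.norm_integral_le_of_norm_le_const
        (a := -θ) (b := θ) (C := C * Real.exp (-R)) (f := fun y => f (rayPoint y R') * rayPoint y R')
        (fun y hy => by
          rw [Set.uIoc_of_le (by linarith)] at hy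
          rw [← hR']
          exact hC R' y (abs_le.2 ⟨hy.1.le, hy.2⟩) (by rw [hR']; exact hR))
      rwa [show θ - -θ = 2 * θ by ring, abs_of_nonneg (by linarith)] at this
    refine (norm_sub_le _ _).trans ?_
    rw [norm_mul, norm_mul, Complex.norm_I]
    have h1 := hh R (abs_of_nonneg hR0)
    have h2 := hh (-R) (by rw [abs_neg, abs_of_nonneg hR0])
    linarith
  have t1 := (intervalIntegral_tendsto_integral hm (tendsto_neg_atTop_atBot) tendsto_id).sub
    (intervalIntegral_tendsto_integral hp (tendsto_neg_atTop_atBot) tendsto_id)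
  have t2 : Tendsto (fun R : ℝ => (∫ x in (-R)..R, f (rayPoint (-θ) x) * rayPoint (-θ) x)
      - (∫ x in (-R)..R, f (rayPoint θ x) * rayPoint θ x)) atTop (𝓝 0) := by
    refine squeeze_zero_norm' (a := fun R => 2 * (C * (2 * θ)) * Real.exp (-R)) ?_ ?_
    · filter_upwards [eventually_ge_atTop X, eventually_ge_atTop 0] with R h1 h2
      rw [key]
      exact hvert R h1 h2
    · have := (Real.tendsto_exp_neg_atTop_nhds_zero).const_mul (2 * (C * (2 * θ)))
      simpa using this
  exact (sub_eq_zero.1 (tendsto_nhds_unique t1 t2)).symm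

/-- `F` is holomorphic in the right half plane, vanishes at `0`, and is bounded by
`B s / (1 + a² s²)`, `s = |z|`, in the closed sector of half opening angle `θ`. -/
structure SectorDecay (θ a B : ℝ) (F : ℂ → ℂ) : Prop where
  diff : DifferentiableOn ℂ F {z | 0 < z.re}
  zero : F 0 = 0
  bound : ∀ z ∈ closedSector θ, ‖F z‖ ≤ B * (‖z‖ / (1 + (a * ‖z‖) ^ 2))

theorem SectorDecay.bound_rayPoint {θ a B : ℝ} {F : ℂ → ℂ} (h : SectorDecay θ a B F)
    (hθ : θ < Real.pi / 2) {y : ℝ} (hy : |y| ≤ θ) (x : ℝ) :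
    ‖F (rayPoint y x)‖ ≤ B * expWeight a x := by
  simpa [norm_rayPoint, expWeight] using h.bound _ (rayPoint_mem_closedSector hθ hy x)

theorem SectorDecay.const_nonneg {θ a B : ℝ} {F : ℂ → ℂ} (h : SectorDecay θ a B F) : 0 ≤ B := by
  have h1 := (norm_nonneg _).trans (h.bound _ (ofReal_mem_closedSector θ zero_le_one))
  simp only [Complex.norm_real, norm_one, mul_one] at h1
  exact nonneg_of_mul_nonneg_left h1 (by positivity)

theorem SectorDecay.continuous_rayPoint {θ a B : ℝ} {F : ℂ → ℂ} (h : SectorDecay θ a B F)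
    {y : ℝ} (hy : |y| < Real.pi / 2) : Continuous fun x => F (rayPoint y x) :=
  h.diff.continuousOn.comp_continuous (_root_.continuous_rayPoint y) fun x => rayPoint_re_pos hy x

theorem expWeight_le_exp (a x : ℝ) : expWeight a x ≤ Real.exp x :=
  div_le_self (Real.exp_pos x).le (by nlinarith [sq_nonneg (a * Real.exp x)])

theorem expWeight_le_exp_neg {a : ℝ} (ha : 0 < a) (x : ℝ) :
    expWeight a x ≤ (a ^ 2)⁻¹ * Real.exp (-x) := by
  unfold expWeight
  rw [Real.exp_neg, ← mul_inv, ← one_div, div_le_div_iff₀ (by positivity) (by positivity)]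
  nlinarith [Real.exp_pos x]

/-! ### Cauchy kernels on the two rays. -/

theorem abs_sin_pos {y : ℝ} (hy0 : y ≠ 0) (hy : |y| < Real.pi / 2) : 0 < |Real.sin y| := by
  refine abs_pos.2 fun h => hy0 ?_
  have := abs_lt.1 hy
  exact (Real.sin_eq_zero_iff_of_lt_of_lt (by linarith [Real.pi_pos]) (by linarith [Real.pi_pos])).1 h

theorem rayPoint_sub_ne_zero {y : ℝ} (hy0 : y ≠ 0) (hy : |y| < Real.pi / 2) (x l : ℝ) :
    rayPoint y x - l ≠ 0 := by
  rw [← norm_pos_iff]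
  exact lt_of_lt_of_le (mul_pos (abs_sin_pos hy0 hy) (Real.exp_pos x))
    (abs_sin_mul_exp_le_norm_sub y x l)

theorem SectorDecay.integrable_kernel {θ a B : ℝ} {F : ℂ → ℂ} (h : SectorDecay θ a B F)
    (ha : 0 < a) (hθ : θ < Real.pi / 2) {y : ℝ} (hy0 : y ≠ 0) (hy : |y| ≤ θ) (l : ℝ) :
    Integrable fun x => F (rayPoint y x) * (rayPoint y x / (rayPoint y x - l)) := by
  have hy' := hy.trans_lt hθ
  have hs := abs_sin_pos hy0 hy'
  refine ((integrable_expWeight ha).const_mul (B * |Real.sin y|⁻¹)).mono' ?_ ?_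
  · exact ((h.continuous_rayPoint hy').mul ((_root_.continuous_rayPoint y).div
      ((_root_.continuous_rayPoint y).sub continuous_const)
      fun x => rayPoint_sub_ne_zero hy0 hy' x l)).aestronglyMeasurable
  · refine Eventually.of_forall fun x => ?_
    rw [norm_mul, norm_div, norm_rayPoint]
    have h1 := h.bound_rayPoint hθ hy x
    have h2 : Real.exp x / ‖rayPoint y x - l‖ ≤ |Real.sin y|⁻¹ := by
      rw [← one_div, div_le_div_iff₀ (norm_pos_iff.2 (rayPoint_sub_ne_zero hy0 hy' x l)) hs]
      linarith [abs_sin_mul_exp_le_norm_sub y x l]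
    calc _ ≤ (B * expWeight a x) * |Real.sin y|⁻¹ := by gcongr; exact (norm_nonneg _).trans h1
      _ = _ := by ring

theorem ofReal_add_rayPoint_ne_zero {y : ℝ} (hy : |y| < Real.pi / 2) (x : ℝ) {l : ℝ}
    (hl : 0 ≤ l) : (l : ℂ) + rayPoint y x ≠ 0 := by
  rw [← norm_pos_iff]
  refine lt_of_lt_of_le ?_ (norm_le_norm_ofReal_add (rayPoint_re_pos hy x).le hl).1
  rw [norm_rayPoint]; exact Real.exp_pos x

/-- The kernel `z / (z - l)` alone tends to 1 at infinity and is not integrable in `x`. Subtracting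
the kernel of the mirror pole `-l`, which lies outside the sector, leaves `2 l z / ((z - l)(l +
z))`, decaying at both ends. -/
theorem integrable_dipole {y : ℝ} (hy0 : y ≠ 0) (hy : |y| < Real.pi / 2) {l : ℝ} (hl : 0 < l) :
    Integrable fun x => rayPoint y x / (rayPoint y x - l) - rayPoint y x / (l + rayPoint y x) := by
  have hs := abs_sin_pos hy0 hy
  have hne := fun x => rayPoint_sub_ne_zero hy0 hy x l
  have hne' := fun x => ofReal_add_rayPoint_ne_zero hy x hl.le
  refine ((integrable_expWeight (inv_pos.2 hl)).const_mul (4 * (|Real.sin y|⁻¹ * l⁻¹))).mono' ?_ ?_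
  · exact (((continuous_rayPoint y).div ((continuous_rayPoint y).sub continuous_const) hne).sub
      ((continuous_rayPoint y).div (continuous_const.add (continuous_rayPoint y)) hne')
      ).aestronglyMeasurable
  · refine Eventually.of_forall fun x => ?_
    have e : rayPoint y x / (rayPoint y x - l) - rayPoint y x / (l + rayPoint y x) =
        2 * l * rayPoint y x / ((rayPoint y x - l) * (l + rayPoint y x)) := by
      have := hne x
      have := hne' x
      field_simp
      ring
    rw [e, norm_div, norm_mul, norm_mul, norm_mul, norm_rayPoint]
    obtain ⟨h1, h2⟩ := norm_le_norm_ofReal_add (rayPoint_re_pos hy x).le hl.le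
    rw [norm_rayPoint] at h1
    have h3 := abs_sin_mul_exp_le_norm_sub y x l
    have h4 := abs_sin_mul_le_norm_sub y x l
    set s := Real.exp x
    have hs0 : 0 < s := Real.exp_pos x
    have h5 : |Real.sin y| * s * s ≤ ‖rayPoint y x - l‖ * ‖(l : ℂ) + rayPoint y x‖ := by gcongr
    have h6 : |Real.sin y| * l * l ≤ ‖rayPoint y x - l‖ * ‖(l : ℂ) + rayPoint y x‖ := by gcongr
    -- Average of the two lower bounds; it produces the weight `expWeight l⁻¹`.
    have h7 : |Real.sin y| * ((s ^ 2 + l ^ 2) / 2) ≤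
      ‖rayPoint y x - l‖ * ‖(l : ℂ) + rayPoint y x‖ := by nlinarith
    refine (div_le_div_of_nonneg_left (by positivity) (by positivity) h7).trans (le_of_eq ?_)
    simp only [Complex.norm_real, Real.norm_of_nonneg hl.le, Complex.norm_ofNat, expWeight]
    change 2 * l * s / _ = _ * (s / (1 + (l⁻¹ * s) ^ 2))
    field_simp
    ring

/-- A primitive is `log ((l - z) / (l + z))`. On the upper ray its argument stays in the open lower
half plane, so the principal branch is smooth there; it runs from `log 1 = 0` to the limit of `log`
at `-1` from below, `-πi`. -/
theorem integral_dipole {y : ℝ} (hy0 : 0 < y) (hy : y < Real.pi / 2) {l : ℝ} (hl : 0 < l) :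
    ∫ x, (rayPoint y x / (rayPoint y x - l) - rayPoint y x / (l + rayPoint y x)) =
      -(Real.pi * Complex.I) := by
  have hy' : |y| < Real.pi / 2 := by rwa [abs_of_pos hy0]
  have hne := fun x => rayPoint_sub_ne_zero hy0.ne' hy' x l
  have hne' := fun x => ofReal_add_rayPoint_ne_zero hy' x hl.le
  have him : ∀ x, ((l - rayPoint y x) / (l + rayPoint y x)).im < 0 := by
    intro x
    have hsin := Real.sin_pos_of_pos_of_lt_pi hy0 (by linarith [Real.pi_pos])
    have hp : 0 < Complex.normSq (l + rayPoint y x) := Complex.normSq_pos.2 (hne' x)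
    rw [Complex.div_im, ← sub_div]
    refine div_neg_of_neg_of_pos ?_ hp
    simp only [Complex.sub_re, Complex.sub_im, Complex.add_re, Complex.add_im, Complex.ofReal_re,
      Complex.ofReal_im, rayPoint_im]
    have := mul_pos hl (mul_pos (Real.exp_pos x) hsin)
    nlinarith
  have hd : ∀ x, HasDerivAt (fun x => Complex.log ((l - rayPoint y x) / (l + rayPoint y x)))
      (rayPoint y x / (rayPoint y x - l) - rayPoint y x / (l + rayPoint y x)) x := by
    intro x
    have h1 := (((hasDerivAt_rayPoint y x).const_sub (l : ℂ)).div
      ((hasDerivAt_rayPoint y x).const_add (l : ℂ)) (hne' x)).clog_real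
      (Or.inr (him x).ne)
    refine h1.congr_deriv ?_
    have := hne x
    have := hne' x
    have h4 : (l : ℂ) - rayPoint y x ≠ 0 := by rw [← neg_sub]; exact neg_ne_zero.2 (hne x)
    simp only [Pi.div_apply]
    field_simp
    ring
  have hbot : Tendsto (rayPoint y) atBot (𝓝 0) := by
    rw [tendsto_zero_iff_norm_tendsto_zero]
    simp_rw [norm_rayPoint]
    exact Real.tendsto_exp_atBot
  have hinv : Tendsto (fun x => (rayPoint y x)⁻¹) atTop (𝓝 0) := by
    rw [tendsto_zero_iff_norm_tendsto_zero]
    simp_rw [norm_inv, norm_rayPoint]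
    exact Real.tendsto_exp_atTop.inv_tendsto_atTop
  have l1 : Tendsto (fun x => Complex.log ((l - rayPoint y x) / (l + rayPoint y x))) atBot (𝓝 0) := by
    have hl' : (l : ℂ) ≠ 0 := by exact_mod_cast hl.ne'
    have : Tendsto (fun x => (l - rayPoint y x) / (l + rayPoint y x)) atBot
        (𝓝 (((l : ℂ) - 0) / (l + 0))) :=
      (tendsto_const_nhds.sub hbot).div (tendsto_const_nhds.add hbot) (by simpa using hl')
    rw [sub_zero, add_zero, div_self hl'] at this
    have h2 := this.clog (by simp [Complex.slitPlane])
    rwa [Complex.log_one] at h2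
  have l2 : Tendsto (fun x => Complex.log ((l - rayPoint y x) / (l + rayPoint y x))) atTop
      (𝓝 (-(Real.pi * Complex.I))) := by
    have h1 : Tendsto (fun x => (l - rayPoint y x) / (l + rayPoint y x)) atTop (𝓝 (-1)) := by
      have : Tendsto (fun x => (l * (rayPoint y x)⁻¹ - 1) / (l * (rayPoint y x)⁻¹ + 1)) atTop
          (𝓝 (((l : ℂ) * 0 - 1) / (l * 0 + 1))) :=
        ((hinv.const_mul _).sub tendsto_const_nhds).div ((hinv.const_mul _).add tendsto_const_nhds)
          (by simp)
      simp only [mul_zero, zero_sub, zero_add, div_one] at this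
      refine this.congr fun x => ?_
      have := rayPoint_ne_zero y x
      have h3 := hne' x
      have h4 : (l : ℂ) * (rayPoint y x)⁻¹ + 1 ≠ 0 := by
        intro h5
        apply h3
        field_simp at h5
        simpa using h5
      field_simp
    have h2 := Complex.tendsto_log_nhdsWithin_im_neg_of_re_neg_of_im_zero (z := -1)
      (by simp) (by simp)
    simp only [norm_neg, norm_one, Real.log_one, Complex.ofReal_zero, zero_sub] at h2
    exact h2.comp (tendsto_nhdsWithin_iff.2 ⟨h1, Eventually.of_forall him⟩)
  rw [integral_of_hasDerivAt_of_tendsto hd (integrable_dipole hy0.ne' hy' hl) l1 l2, sub_zero]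

theorem rayPoint_neg (y x : ℝ) : rayPoint (-y) x = (starRingEnd ℂ) (rayPoint y x) := by
  simp [rayPoint, ← Complex.exp_conj]

theorem integral_dipole_neg {y : ℝ} (hy0 : 0 < y) (hy : y < Real.pi / 2) {l : ℝ} (hl : 0 < l) :
    ∫ x, (rayPoint (-y) x / (rayPoint (-y) x - l) - rayPoint (-y) x / (l + rayPoint (-y) x)) =
      Real.pi * Complex.I := by
  have := congrArg (starRingEnd ℂ) (integral_dipole hy0 hy hl)
  rw [← integral_conj] at this
  simp only [rayPoint_neg]
  convert this using 1
  · congr 1; ext x; simp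
  · simp

/-- Cauchy's integral formula on the boundary of a sector. -/
theorem SectorDecay.integral_kernel {θ a B : ℝ} {F : ℂ → ℂ} (h : SectorDecay θ a B F)
    (ha : 0 < a) (h0 : 0 < θ) (hθ : θ < Real.pi / 2) {l : ℝ} (hl : 0 ≤ l) :
    ∫ x, (F (rayPoint θ x) * (rayPoint θ x / (rayPoint θ x - l)) -
      F (rayPoint (-θ) x) * (rayPoint (-θ) x / (rayPoint (-θ) x - l))) =
      -(2 * Real.pi * Complex.I) * F l := by
  have hB := h.const_nonneg
  have a1 : |θ| ≤ θ := by rw [abs_of_pos h0]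
  have a2 : |-θ| ≤ θ := by rw [abs_neg, abs_of_pos h0]
  have a1' := a1.trans_lt hθ
  have a2' := a2.trans_lt hθ
  have i1 := h.integrable_kernel ha hθ h0.ne' a1 l
  have i2 := h.integrable_kernel ha hθ (neg_ne_zero.2 h0.ne') a2 l
  rw [integral_sub i1 i2]
  rcases hl.eq_or_lt with rfl | hl
  -- At `l = 0` the kernel is 1 and the pole sits at the vertex of the sector. The bound on `F`
  -- makes both ray integrals converge, they agree by Cauchy's theorem, and the right side vanishes
  -- since `F 0 = 0`.
  · have e : ∀ y x, F (rayPoint y x) * (rayPoint y x / (rayPoint y x - (0 : ℝ))) =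
        (F (rayPoint y x) / rayPoint y x) * rayPoint y x := by
      intro y x
      have := rayPoint_ne_zero y x
      simp only [Complex.ofReal_zero, sub_zero]
      field_simp
    simp only [e] at i1 i2 ⊢
    rw [integral_rayPoint_eq (f := fun z => F z / z) h0.le hθ ?_ i1 i2
      (C := B + B * (a ^ 2)⁻¹) (X := 0) ?_]
    · simp [h.zero]
    · refine h.diff.div differentiableOn_id fun z hz => ?_
      rintro rfl
      simp at hz
    · intro x y hy _
      rw [div_mul_cancel₀ _ (rayPoint_ne_zero y x)]
      refine (h.bound_rayPoint hθ hy x).trans ?_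
      have hE := Real.exp_pos (-|x|)
      rcases le_total 0 x with hx | hx
      · rw [abs_of_nonneg hx] at hE ⊢
        nlinarith [mul_le_mul_of_nonneg_left (expWeight_le_exp_neg ha x) hB]
      · rw [abs_of_nonpos hx, neg_neg] at hE ⊢
        nlinarith [mul_le_mul_of_nonneg_left (expWeight_le_exp a x) hB,
          mul_nonneg hB (inv_nonneg.2 (sq_nonneg a))]
  -- The correction equals `F l` at `z = l`, is holomorphic in the right half plane and decays at
  -- infinity. Hence `dslope H l` is holomorphic across `l`, Cauchy's theorem applies without
  -- indenting the contour, and the residue is carried by the two explicit dipole integrals.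
  · set H : ℂ → ℂ := fun z => F z - F l * (2 * l / (l + z)) with hH
    have hl' : (l : ℂ) ≠ 0 := by exact_mod_cast hl.ne'
    have hHl : H l = 0 := by
      simp only [hH]
      rw [← two_mul, div_self (mul_ne_zero two_ne_zero hl'), mul_one, sub_self]
    have hg : ∀ y x, rayPoint y x ≠ l → dslope H l (rayPoint y x) * rayPoint y x =
        H (rayPoint y x) * (rayPoint y x / (rayPoint y x - l)) := by
      intro y x hne
      rw [dslope_of_ne _ hne, slope_def_field, hHl, sub_zero]
      ring
    have e : ∀ y, |y| < Real.pi / 2 → y ≠ 0 → ∀ x, dslope H l (rayPoint y x) * rayPoint y x =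
        F (rayPoint y x) * (rayPoint y x / (rayPoint y x - l)) -
        F l * (rayPoint y x / (rayPoint y x - l) - rayPoint y x / (l + rayPoint y x)) := by
      intro y hy hy0 x
      have h1 := rayPoint_sub_ne_zero hy0 hy x l
      have h2 := ofReal_add_rayPoint_ne_zero hy x hl.le
      rw [hg y x (sub_ne_zero.1 h1), hH]
      field_simp
      ring
    have i1' := i1.sub ((integrable_dipole h0.ne' a1' hl).const_mul (F l))
    have i2' := i2.sub ((integrable_dipole (neg_ne_zero.2 h0.ne') a2' hl).const_mul (F l))
    have hd : DifferentiableOn ℂ (dslope H l) {z | 0 < z.re} := by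
      rw [Complex.differentiableOn_dslope
        ((isOpen_lt continuous_const Complex.continuous_re).mem_nhds (by simpa using hl))]
      refine h.diff.sub ((differentiableOn_const _).mul ((differentiableOn_const _).div
        ((differentiableOn_const _).add differentiableOn_id) fun z hz => ?_))
      intro h1
      have := congrArg Complex.re h1
      simp only [Complex.add_re, Complex.ofReal_re, Complex.zero_re] at this
      have : (0 : ℝ) < z.re := hz
      linarith
    have key := integral_rayPoint_eq (f := dslope H l) h0.le hθ hd
      (by simp only [e θ a1' h0.ne']; exact i1')
      (by simp only [e (-θ) a2' (neg_ne_zero.2 h0.ne')]; exact i2')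
      -- For `|x| ≥ X` either `exp x ≥ 2l` or `exp x ≤ l/2`, so `z` stays away from `l` and `dslope`
      -- is the plain quotient. The two summands of `C` serve the ends `+∞` and `-∞`.
      (C := 2 * (B * (a ^ 2)⁻¹ + ‖F l‖ * (2 * l)) + 2 / l * (B * l + ‖F l‖ * 2))
      (X := |Real.log (2 * l)| + |Real.log (l / 2)|) (by
        intro x y hy hx
        have hy' := hy.trans_lt hθ
        have hE := Real.exp_pos (-|x|)
        have hF := h.bound_rayPoint hθ hy x
        obtain ⟨n1, n2⟩ := norm_le_norm_ofReal_add (rayPoint_re_pos hy' x).le hl.le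
        have hHn : ‖H (rayPoint y x)‖ ≤
            ‖F (rayPoint y x)‖ + ‖F l‖ * (2 * l / ‖(l : ℂ) + rayPoint y x‖) := by
          refine (norm_sub_le _ _).trans (le_of_eq ?_)
          rw [norm_mul, norm_div, norm_mul, Complex.norm_ofNat, Complex.norm_real,
            Real.norm_of_nonneg hl.le]
        rw [norm_rayPoint] at n1
        have hs := Real.exp_pos x
        rcases le_total 0 x with hx0 | hx0
        · rw [abs_of_nonneg hx0] at hE hx ⊢
          have h2 : 2 * l ≤ Real.exp x := by
            rw [← Real.log_le_iff_le_exp (by positivity)]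
            linarith [le_abs_self (Real.log (2 * l)), abs_nonneg (Real.log (l / 2))]
          have hsub : Real.exp x / 2 ≤ ‖rayPoint y x - l‖ := by
            have := norm_sub_norm_le (rayPoint y x) l
            rw [norm_rayPoint, Complex.norm_real, Real.norm_of_nonneg hl.le] at this
            linarith
          have hne : rayPoint y x ≠ l := by
            intro h3
            rw [h3, sub_self, norm_zero] at hsub
            linarith
          rw [hg y x hne, norm_mul, norm_div, norm_rayPoint]
          have q1 : Real.exp x / ‖rayPoint y x - l‖ ≤ 2 := by
            rw [div_le_iff₀ (by linarith)]; linarith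
          have q2 : 2 * l / ‖(l : ℂ) + rayPoint y x‖ ≤ 2 * l * Real.exp (-x) := by
            rw [Real.exp_neg, ← div_eq_mul_inv]
            gcongr
          have q3 : ‖H (rayPoint y x)‖ ≤ B * ((a ^ 2)⁻¹ * Real.exp (-x)) +
              ‖F l‖ * (2 * l * Real.exp (-x)) := by
            refine hHn.trans (add_le_add (hF.trans ?_) ?_)
            · exact mul_le_mul_of_nonneg_left (expWeight_le_exp_neg ha x) hB
            · gcongr
          calc _ ≤ (B * ((a ^ 2)⁻¹ * Real.exp (-x)) + ‖F l‖ * (2 * l * Real.exp (-x))) * 2 := by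
                gcongr
            _ = 2 * (B * (a ^ 2)⁻¹ + ‖F l‖ * (2 * l)) * Real.exp (-x) := by ring
            _ ≤ _ := by
                gcongr
                exact le_add_of_nonneg_right (by positivity)
        · rw [abs_of_nonpos hx0] at hE hx ⊢
          rw [neg_neg] at hE ⊢
          have h2 : Real.exp x ≤ l / 2 := by
            rw [← Real.le_log_iff_exp_le (by positivity)]
            linarith [neg_abs_le (Real.log (l / 2)), abs_nonneg (Real.log (2 * l))]
          have hsub : l / 2 ≤ ‖rayPoint y x - l‖ := by
            have := norm_sub_norm_le (l : ℂ) (rayPoint y x)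
            rw [norm_rayPoint, Complex.norm_real, Real.norm_of_nonneg hl.le, norm_sub_rev] at this
            linarith
          have hne : rayPoint y x ≠ l := by
            intro h3
            rw [h3, sub_self, norm_zero] at hsub
            linarith
          rw [hg y x hne, norm_mul, norm_div, norm_rayPoint]
          have q1 : Real.exp x / ‖rayPoint y x - l‖ ≤ 2 / l * Real.exp x := by
            rw [div_le_iff₀ (by linarith)]
            calc Real.exp x = 2 / l * Real.exp x * (l / 2) := by field_simp
              _ ≤ _ := by gcongr
          have q2 : 2 * l / ‖(l : ℂ) + rayPoint y x‖ ≤ 2 := by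
            rw [div_le_iff₀ (by linarith)]; linarith
          have q3 : ‖H (rayPoint y x)‖ ≤ B * l + ‖F l‖ * 2 := by
            refine hHn.trans (add_le_add (hF.trans ?_) ?_)
            · exact mul_le_mul_of_nonneg_left ((expWeight_le_exp a x).trans (by linarith)) hB
            · gcongr
          calc _ ≤ (B * l + ‖F l‖ * 2) * (2 / l * Real.exp x) := by gcongr
            _ = 2 / l * (B * l + ‖F l‖ * 2) * Real.exp x := by ring
            _ ≤ _ := by
                gcongr
                exact le_add_of_nonneg_left (by positivity))
    simp only [e θ a1' h0.ne', e (-θ) a2' (neg_ne_zero.2 h0.ne')] at key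
    rw [integral_sub i1 ((integrable_dipole h0.ne' a1' hl).const_mul (F l)),
      integral_sub i2 ((integrable_dipole (neg_ne_zero.2 h0.ne') a2' hl).const_mul (F l)),
      integral_const_mul, integral_const_mul, integral_dipole h0 hθ hl,
      integral_dipole_neg h0 hθ hl] at key
    linear_combination key

/-! ### The scalar discontinuous Galerkin element on the unit interval -/

/-- Coefficient vectors of complex polynomials of degree at most `q`. -/
abbrev TimePoly (q : ℕ) : Type := Fin (q + 1) → ℂ

namespace TimePoly

variable {q : ℕ}

/-- Evaluation of a polynomial at `t`. -/
noncomputable def ev (t : ℝ) : TimePoly q →ₗ[ℂ] ℂ :=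
  ∑ j : Fin (q + 1), ((t : ℂ) ^ (j : ℕ)) • LinearMap.proj j

theorem ev_apply (t : ℝ) (p : TimePoly q) : ev t p = ∑ j : Fin (q + 1), (t : ℂ) ^ (j : ℕ) * p j := by
  simp [ev, LinearMap.sum_apply]

/-- The derivative of a polynomial. -/
noncomputable def der : TimePoly q →ₗ[ℂ] TimePoly q where
  toFun p j := if h : (j : ℕ) < q then ((j : ℕ) + 1 : ℂ) * p ⟨j + 1, by omega⟩ else 0
  map_add' p p' := by ext j; by_cases h : (j : ℕ) < q <;> simp [h, mul_add]
  map_smul' c p := by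
    ext j
    by_cases h : (j : ℕ) < q
    · simp only [h, dite_true, Pi.smul_apply, smul_eq_mul, RingHom.id_apply]; ring
    · simp [h]

theorem der_apply (p : TimePoly q) (j : Fin (q + 1)) :
    der p j = if h : (j : ℕ) < q then ((j : ℕ) + 1 : ℂ) * p ⟨j + 1, by omega⟩ else 0 := rfl

theorem der_last (p : TimePoly q) : der p (Fin.last q) = 0 := by simp [der_apply]

theorem ev_zero (p : TimePoly q) : ev 0 p = p 0 := by
  rw [ev_apply, Fin.sum_univ_succ]
  simp

theorem hasDerivAt_ev (p : TimePoly q) (t : ℝ) :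
    HasDerivAt (fun s : ℝ => ev s p) (ev t (der p)) t := by
  have h : HasDerivAt (fun s : ℝ => ∑ j : Fin (q + 1), (s : ℂ) ^ (j : ℕ) * p j)
      (∑ j : Fin (q + 1), (((j : ℕ) : ℂ) * (t : ℂ) ^ ((j : ℕ) - 1)) * p j) t := by
    refine HasDerivAt.fun_sum fun j _ => ?_
    exact ((hasDerivAt_pow (j : ℕ) (t : ℂ)).comp_ofReal).mul_const _
  simp_rw [ev_apply]
  refine h.congr_deriv ?_
  rw [Fin.sum_univ_succ, Fin.sum_univ_castSucc (fun j => (t : ℂ) ^ (j : ℕ) * der p j), der_last]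
  simp only [Fin.val_zero, Nat.cast_zero, zero_mul, zero_add, mul_zero, add_zero]
  refine Finset.sum_congr rfl fun i _ => ?_
  rw [der_apply, dif_pos (by simp)]
  simp only [Fin.val_succ, Nat.add_sub_cancel, Fin.val_castSucc, Nat.cast_add, Nat.cast_one]
  have : (⟨(i : ℕ) + 1, by omega⟩ : Fin (q + 1)) = i.succ := rfl
  rw [this]
  ring

theorem continuous_ev (p : TimePoly q) : Continuous fun t : ℝ => ev t p :=
  continuous_iff_continuousAt.2 fun t => (hasDerivAt_ev p t).continuousAt

theorem ev_star (t : ℝ) (p : TimePoly q) : ev t (star p) = (starRingEnd ℂ) (ev t p) := by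
  simp [ev_apply]

theorem der_star (p : TimePoly q) : der (star p) = star (der p) := by
  ext j
  by_cases h : (j : ℕ) < q <;> simp [der_apply, h]

theorem eq_zero_of_ev_eq_zero (p : TimePoly q) (h : ∀ t ∈ Set.Ioo (0 : ℝ) 1, ev t p = 0) :
    p = 0 := by
  set P : Polynomial ℂ := ∑ j : Fin (q + 1), Polynomial.monomial (j : ℕ) (p j) with hP
  have hP0 : P = 0 := by
    refine Polynomial.eq_zero_of_infinite_isRoot P (Set.Infinite.mono ?_
      ((Set.Ioo_infinite (zero_lt_one' ℝ)).image (Complex.ofReal_injective.injOn)))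
    rintro _ ⟨t, ht, rfl⟩
    have := h t ht
    rw [ev_apply] at this
    simp only [Set.mem_ofPred_eq, Polynomial.IsRoot.def, hP, Polynomial.eval_finsetSum,
      Polynomial.eval_monomial]
    rw [← this]
    exact Finset.sum_congr rfl fun j _ => mul_comm _ _
  ext i
  have := congrArg (fun Q => Polynomial.coeff Q (i : ℕ)) hP0
  simp only [hP, Polynomial.finsetSum_coeff, Polynomial.coeff_monomial, Polynomial.coeff_zero,
    Fin.val_inj] at this
  simpa using this

/-- The weight 1 gives nondegeneracy of the `L²` pairing; the weight `t` is needed for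
`evalRep_last_ne_zero`. -/
theorem eq_zero_of_integral_eq_zero {w : ℝ → ℝ} (hw : Continuous w)
    (hpos : ∀ t ∈ Set.Ioc (0 : ℝ) 1, 0 < w t) (p : TimePoly q)
    (h : ∫ t in (0 : ℝ)..1, w t * ‖ev t p‖ ^ 2 = 0) : p = 0 := by
  refine eq_zero_of_ev_eq_zero p fun t ht => ?_
  by_contra hne
  refine h.not_gt (intervalIntegral.integral_pos zero_lt_one ?_ (fun x hx => ?_)
    ⟨t, ⟨ht.1.le, ht.2.le⟩, ?_⟩)
  · exact (hw.mul ((continuous_ev p).norm.pow 2)).continuousOn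
  · exact mul_nonneg (hpos x hx).le (sq_nonneg _)
  · exact mul_pos (hpos t ⟨ht.1, ht.2.le⟩) (pow_pos (norm_pos_iff.2 hne) 2)

/-- The `L²(0,1)` pairing `∫ p φ` (bilinear). -/
noncomputable def pairing : TimePoly q →ₗ[ℂ] Module.Dual ℂ (TimePoly q) :=
  LinearMap.mk₂ ℂ (fun p φ => ∫ t in (0 : ℝ)..1, ev t p * ev t φ)
    (fun p p' φ => by
      simp only [map_add, add_mul]
      exact intervalIntegral.integral_add
        (((continuous_ev p).mul (continuous_ev φ)).intervalIntegrable _ _)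
        (((continuous_ev p').mul (continuous_ev φ)).intervalIntegrable _ _))
    (fun c p φ => by
      simp only [map_smul, smul_eq_mul, mul_assoc, intervalIntegral.integral_const_mul])
    (fun p φ φ' => by
      simp only [map_add, mul_add]
      exact intervalIntegral.integral_add
        (((continuous_ev p).mul (continuous_ev φ)).intervalIntegrable _ _)
        (((continuous_ev p).mul (continuous_ev φ')).intervalIntegrable _ _))
    (fun c p φ => by
      simp only [map_smul, smul_eq_mul, mul_left_comm _ c, intervalIntegral.integral_const_mul])

theorem pairing_apply (p φ : TimePoly q) :
    pairing p φ = ∫ t in (0 : ℝ)..1, ev t p * ev t φ := rfl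

/-- The pairing is bilinear, so that the scalar problem is holomorphic in its parameter; positivity
is recovered by testing with the conjugate polynomial. -/
theorem pairing_star (p : TimePoly q) :
    pairing p (star p) = ((∫ t in (0 : ℝ)..1, ‖ev t p‖ ^ 2 : ℝ) : ℂ) := by
  rw [pairing_apply, ← intervalIntegral.integral_ofReal]
  refine intervalIntegral.integral_congr fun t _ => ?_
  simp only [ev_star, Complex.mul_conj, Complex.normSq_eq_norm_sq]

theorem eq_zero_of_pairing_star (p : TimePoly q) (h : pairing p (star p) = 0) : p = 0 := by
  rw [pairing_star] at h
  refine eq_zero_of_integral_eq_zero (w := fun _ => 1) continuous_const (fun _ _ => one_pos) p ?_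
  simpa using h

theorem pairing_injective : Function.Injective (pairing (q := q)) :=
  (injective_iff_map_eq_zero _).2 fun p hp => eq_zero_of_pairing_star p (by rw [hp]; rfl)

/-- The pairing as an isomorphism with the dual space. -/
noncomputable def pairingEquiv : TimePoly q ≃ₗ[ℂ] Module.Dual ℂ (TimePoly q) :=
  LinearMap.linearEquivOfInjective pairing pairing_injective Subspace.dual_finrank_eq.symm

theorem pairing_pairingEquiv_symm (f : Module.Dual ℂ (TimePoly q)) :
    pairing (pairingEquiv.symm f) = f :=
  pairingEquiv.apply_symm_apply f

/-- The form `∫ p' φ + p(0) φ(0)`. -/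
noncomputable def transport : TimePoly q →ₗ[ℂ] Module.Dual ℂ (TimePoly q) :=
  pairing ∘ₗ der + LinearMap.smulRight (ev 0) (ev 0)

theorem transport_apply (p φ : TimePoly q) :
    transport p φ = pairing (der p) φ + ev 0 p * ev 0 φ := rfl

/-- The representer of the evaluation at `0`. -/
noncomputable def evalRep (q : ℕ) : TimePoly q := pairingEquiv.symm (ev 0)

theorem pairing_evalRep : pairing (evalRep q) = ev 0 := pairing_pairingEquiv_symm _

/-- The operator of the form `transport` with respect to `pairing`. -/
noncomputable def transportOp (q : ℕ) : TimePoly q →L[ℂ] TimePoly q :=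
  LinearMap.toContinuousLinearMap (pairingEquiv.symm.toLinearMap ∘ₗ transport)

theorem pairing_transportOp (p : TimePoly q) : pairing (transportOp q p) = transport p :=
  pairing_pairingEquiv_symm _

/-- `p` is the dG step for the parameter `μ` with initial value `c`. -/
def IsStep (μ c : ℂ) (p : TimePoly q) : Prop :=
  ∀ φ, pairing (der p) φ + μ * pairing p φ + (ev 0 p - c) * ev 0 φ = 0

/-- Representing all functionals through the pairing turns the variational problem into `(μ + S) p =
c ℓ`, so its solution is a resolvent applied to a fixed vector. -/
theorem isStep_iff (μ c : ℂ) (p : TimePoly q) :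
    IsStep μ c p ↔ μ • p + transportOp q p = c • evalRep q := by
  rw [← pairing_injective.eq_iff, LinearMap.ext_iff]
  refine forall_congr' fun φ => ?_
  simp only [map_add, map_smul, pairing_evalRep, pairing_transportOp, LinearMap.add_apply,
    LinearMap.smul_apply, smul_eq_mul, transport_apply]
  rw [← sub_eq_zero (b := c * ev 0 φ)]
  refine Eq.congr ?_ rfl
  ring

/-- Integration by parts: `2 Re (p' p̄)` is the derivative of `|p|²`. -/
theorem re_pairing_der (p : TimePoly q) :
    (pairing (der p) (star p)).re = (‖ev 1 p‖ ^ 2 - ‖ev 0 p‖ ^ 2) / 2 := by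
  have h1 : ∫ t in (0 : ℝ)..1, (ev t (der p) * ev t (star p) + ev t p * ev t (der (star p))) =
      ev 1 p * ev 1 (star p) - ev 0 p * ev 0 (star p) :=
    intervalIntegral.integral_eq_sub_of_hasDerivAt
      (f := fun t => ev t p * ev t (star p))
      (fun t _ => (hasDerivAt_ev p t).mul (hasDerivAt_ev (star p) t))
      ((((continuous_ev _).mul (continuous_ev _)).add
        ((continuous_ev _).mul (continuous_ev _))).intervalIntegrable _ _)
  have hc : ∀ p φ : TimePoly q, IntervalIntegrable (fun t => ev t p * ev t φ) volume 0 1 :=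
    fun p φ => ((continuous_ev p).mul (continuous_ev φ)).intervalIntegrable _ _
  rw [intervalIntegral.integral_add (hc _ _) (hc _ _)] at h1
  have h2 : ∫ t in (0 : ℝ)..1, ev t p * ev t (der (star p)) =
      (starRingEnd ℂ) (pairing (der p) (star p)) := by
    rw [pairing_apply, intervalIntegral.integral_of_le zero_le_one,
      intervalIntegral.integral_of_le zero_le_one, ← integral_conj]
    refine integral_congr_ae (Eventually.of_forall fun t => ?_)
    simp only [der_star, ev_star, map_mul, Complex.conj_conj]
    ring
  rw [h2, ← pairing_apply, ev_star, ev_star, Complex.mul_conj, Complex.mul_conj,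
    Complex.add_conj, Complex.normSq_eq_norm_sq, Complex.normSq_eq_norm_sq] at h1
  have := congrArg Complex.re h1
  simp only [Complex.ofReal_re, Complex.sub_re] at this
  linarith

/-- Test with `p̄`; the initial term is rewritten by polarization, which produces the square of the
jump. -/
theorem IsStep.energy {μ c : ℂ} {p : TimePoly q} (h : IsStep μ c p) :
    ‖ev 1 p‖ ^ 2 + ‖ev 0 p - c‖ ^ 2 + 2 * μ.re * ∫ t in (0 : ℝ)..1, ‖ev t p‖ ^ 2 = ‖c‖ ^ 2 := by
  have h1 := congrArg Complex.re (h (star p))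
  rw [pairing_star, Complex.add_re, Complex.add_re, re_pairing_der, Complex.re_mul_ofReal,
    ev_star] at h1
  have h2 : ((ev 0 p - c) * (starRingEnd ℂ) (ev 0 p)).re =
      (‖ev 0 p‖ ^ 2 + ‖ev 0 p - c‖ ^ 2 - ‖c‖ ^ 2) / 2 := by
    simp only [← Complex.normSq_eq_norm_sq, Complex.normSq_apply, Complex.mul_re, Complex.sub_re,
      Complex.sub_im, Complex.conj_re, Complex.conj_im]
    ring
  rw [h2, Complex.zero_re] at h1
  linarith

theorem integral_sq_nonneg (p : TimePoly q) : 0 ≤ ∫ t in (0 : ℝ)..1, ‖ev t p‖ ^ 2 :=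
  intervalIntegral.integral_nonneg zero_le_one fun _ _ => sq_nonneg _

/-- For `Re μ > 0` the energy identity kills the `L²` norm. For `μ = 0` it only gives `p(0) = 0`,
and testing with the conjugate of `p'` then shows that `p` is constant. The value 0 is needed
because closed sectors contain it and eigenvalues are only known to be nonnegative. -/
theorem IsStep.eq_zero {μ : ℂ} (hμ : 0 < μ.re ∨ μ = 0) {p : TimePoly q} (h : IsStep μ 0 p) :
    p = 0 := by
  have he := h.energy
  have hI := integral_sq_nonneg p
  have hre : 0 ≤ μ.re := by
    rcases hμ with hμ | rfl
    · exact hμ.le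
    · simp
  rw [sub_zero, norm_zero] at he
  have h0 : ev 0 p = 0 := by
    rw [← norm_eq_zero, ← sq_eq_zero_iff]
    nlinarith [sq_nonneg ‖ev 1 p‖, sq_nonneg ‖ev 0 p‖, mul_nonneg hre hI]
  rcases hμ with hμ | rfl
  · refine eq_zero_of_pairing_star p ?_
    rw [pairing_star, Complex.ofReal_eq_zero]
    nlinarith [sq_nonneg ‖ev 1 p‖, sq_nonneg ‖ev 0 p‖]
  · have h1 : der p = 0 := by
      refine eq_zero_of_pairing_star _ ?_
      have := h (star (der p))
      simpa [h0] using this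
    refine eq_zero_of_ev_eq_zero p fun t _ => ?_
    have := is_const_of_deriv_eq_zero (f := fun t : ℝ => ev t p)
      (fun t => (hasDerivAt_ev p t).differentiableAt)
      (fun t => by rw [(hasDerivAt_ev p t).deriv, h1, map_zero]) t 0
    rw [← h0]
    exact this

theorem mem_resolventSet {μ : ℂ} (hμ : 0 < μ.re ∨ μ = 0) :
    μ ∈ resolventSet ℂ (-transportOp q) := by
  rw [spectrum.mem_resolventSet_iff, ContinuousLinearMap.isUnit_iff_bijective]
  have hinj : Function.Injective (algebraMap ℂ (TimePoly q →L[ℂ] TimePoly q) μ - -transportOp q) := by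
    refine (injective_iff_map_eq_zero _).2 fun p hp => ?_
    refine IsStep.eq_zero hμ ((isStep_iff μ 0 p).2 ?_)
    rw [zero_smul, ← hp, sub_neg_eq_add, _root_.add_apply, Algebra.algebraMap_eq_smul_one]
    rfl
  refine ⟨hinj, ?_⟩
  exact LinearMap.injective_iff_surjective
    (f := (algebraMap ℂ (TimePoly q →L[ℂ] TimePoly q) μ - -transportOp q).toLinearMap).1 hinj

/-- The dG step with initial value `1`, as a function of the parameter. -/
noncomputable def step (q : ℕ) (μ : ℂ) : TimePoly q := resolvent (-transportOp q) μ (evalRep q)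

theorem smul_step_add {μ : ℂ} (hμ : 0 < μ.re ∨ μ = 0) :
    μ • step q μ + transportOp q (step q μ) = evalRep q := by
  have h := (mem_resolventSet (q := q) hμ)
  rw [spectrum.mem_resolventSet_iff] at h
  have h1 := congrArg (fun f : TimePoly q →L[ℂ] TimePoly q => f (evalRep q))
    (Ring.mul_inverse_cancel _ h)
  simp only [sub_neg_eq_add, Algebra.algebraMap_eq_smul_one] at h1
  simpa [step, resolvent, Algebra.algebraMap_eq_smul_one] using h1

theorem isStep_step {μ : ℂ} (hμ : 0 < μ.re ∨ μ = 0) : IsStep μ 1 (step q μ) := by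
  rw [isStep_iff, one_smul, smul_step_add hμ]

theorem IsStep.eq_smul_step {μ c : ℂ} (hμ : 0 < μ.re ∨ μ = 0) {p : TimePoly q}
    (h : IsStep μ c p) : p = c • step q μ := by
  refine sub_eq_zero.1 (IsStep.eq_zero hμ ((isStep_iff _ _ _).2 ?_))
  rw [isStep_iff] at h
  rw [zero_smul, smul_sub, map_sub, map_smul, smul_comm, sub_add_sub_comm, h, ← smul_add,
    smul_step_add hμ, sub_self]

/-- Strong form of the step: the test polynomial is removed by nondegeneracy of the pairing. -/
theorem IsStep.der_add {μ c : ℂ} {p : TimePoly q} (h : IsStep μ c p) :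
    der p + μ • p + (ev 0 p - c) • evalRep q = 0 := by
  refine (injective_iff_map_eq_zero _).1 pairing_injective _ (LinearMap.ext fun φ => ?_)
  rw [LinearMap.zero_apply, ← h φ]
  simp [pairing_evalRep]

/-- If the leading coefficient of `ℓ` vanished, `t · ℓ̄` would be an admissible test polynomial
vanishing at 0. Then `∫ t |ℓ|² = 0`, hence `ℓ = 0`, although evaluation at 0 is not the zero
functional. -/
theorem evalRep_last_ne_zero : evalRep q (Fin.last q) ≠ 0 := by
  intro h0
  set φ : TimePoly q := Fin.cons 0 fun i : Fin q => star (evalRep q) i.castSucc with hφ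
  have hev : ∀ t : ℝ, ev t φ = t * (starRingEnd ℂ) (ev t (evalRep q)) := by
    intro t
    rw [← ev_star, ev_apply, ev_apply, Fin.sum_univ_succ, Fin.sum_univ_castSucc]
    simp only [hφ, Fin.cons_zero, Fin.cons_succ, Pi.star_apply, h0, star_zero, mul_zero, zero_add,
      add_zero, Finset.mul_sum, Fin.val_succ, Fin.val_castSucc]
    exact Finset.sum_congr rfl fun i _ => by ring
  have h1 : pairing (evalRep q) φ = 0 := by
    rw [pairing_evalRep, hev]; simp
  have h2 : pairing (evalRep q) φ =
      ((∫ t in (0 : ℝ)..1, t * ‖ev t (evalRep q)‖ ^ 2 : ℝ) : ℂ) := by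
    rw [pairing_apply, ← intervalIntegral.integral_ofReal]
    refine intervalIntegral.integral_congr fun t _ => ?_
    simp only [hev, Complex.ofReal_mul, ← Complex.normSq_eq_norm_sq, ← Complex.mul_conj]
    ring
  rw [h2, Complex.ofReal_eq_zero] at h1
  have h3 := eq_zero_of_integral_eq_zero continuous_id (fun t ht => ht.1) _ h1
  have h4 : (ev 0 : TimePoly q →ₗ[ℂ] ℂ) (Pi.single 0 1) = 0 := by
    rw [← pairing_evalRep, h3]; simp
  rw [ev_zero] at h4
  simp at h4

/-- The derivative has no term of degree `q`, so comparing top coefficients in the strong form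
isolates the jump as `μ` times a linear functional of `p`. -/
theorem IsStep.jump_eq {μ c : ℂ} {p : TimePoly q} (h : IsStep μ c p) :
    ev 0 p - c = -(μ * p (Fin.last q) / evalRep q (Fin.last q)) := by
  have h1 := congrFun h.der_add (Fin.last q)
  simp only [Pi.add_apply, Pi.smul_apply, smul_eq_mul, der_last, Pi.zero_apply, zero_add] at h1
  have := evalRep_last_ne_zero (q := q)
  field_simp
  linear_combination h1

end TimePoly

/-! ### Decay of the scalar step and of its amplification factor in a sector. -/

namespace TimePoly

variable {q : ℕ}

/-- Equivalence of norms on polynomials of degree at most `q`, by compactness of the unit sphere. -/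
theorem exists_norm_sq_le_integral (q : ℕ) : ∃ C : ℝ, 0 < C ∧ ∀ p : TimePoly q,
    ‖p‖ ^ 2 ≤ C * ∫ t in (0 : ℝ)..1, ‖ev t p‖ ^ 2 := by
  have hcont : Continuous fun p : TimePoly q => ∫ t in (0 : ℝ)..1, ‖ev t p‖ ^ 2 := by
    refine intervalIntegral.continuous_parametric_intervalIntegral_of_continuous' ?_ _ _
    simp only [Function.uncurry_def, ev_apply]
    fun_prop
  have hpos : ∀ p : TimePoly q, p ≠ 0 → 0 < ∫ t in (0 : ℝ)..1, ‖ev t p‖ ^ 2 := by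
    intro p hp
    refine lt_of_le_of_ne (integral_sq_nonneg p) fun h => hp ?_
    exact eq_zero_of_pairing_star p (by rw [pairing_star, ← h, Complex.ofReal_zero])
  obtain ⟨p₀, hp₀, hmin⟩ := (isCompact_sphere (0 : TimePoly q) 1).exists_isMinOn
    (NormedSpace.sphere_nonempty.2 zero_le_one) hcont.continuousOn
  have hp₀' : p₀ ≠ 0 := ne_zero_of_mem_unit_sphere ⟨p₀, hp₀⟩
  refine ⟨(∫ t in (0 : ℝ)..1, ‖ev t p₀‖ ^ 2)⁻¹, inv_pos.2 (hpos p₀ hp₀'), fun p => ?_⟩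
  rcases eq_or_ne p 0 with rfl | hp
  · simp
  have hn : 0 < ‖p‖ := norm_pos_iff.2 hp
  have h1 := hmin (a := ((‖p‖⁻¹ : ℝ) : ℂ) • p) (by
    rw [mem_sphere_zero_iff_norm, norm_smul, Complex.norm_real, norm_inv, norm_norm,
      inv_mul_cancel₀ hn.ne'])
  simp only [Set.mem_ofPred_eq, map_smul, norm_smul, mul_pow, intervalIntegral.integral_const_mul,
    Complex.norm_real, norm_inv, norm_norm] at h1
  rw [inv_mul_eq_div, le_div_iff₀ (hpos p₀ hp₀'), mul_comm]
  rwa [inv_pow, inv_mul_eq_div, le_div_iff₀ (by positivity)] at h1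

theorem norm_ev_le {t : ℝ} (ht : t ∈ Set.Icc (0 : ℝ) 1) (p : TimePoly q) :
    ‖ev t p‖ ≤ (q + 1) * ‖p‖ := by
  rw [ev_apply]
  refine (norm_sum_le _ _).trans ?_
  refine (Finset.sum_le_sum (g := fun _ => ‖p‖) fun j _ => ?_).trans (by simp)
  rw [norm_mul, norm_pow, Complex.norm_real, Real.norm_of_nonneg ht.1]
  exact (mul_le_of_le_one_left (norm_nonneg _) (pow_le_one₀ ht.1 ht.2)).trans (norm_le_pi_norm p j)

theorem differentiableAt_step {μ : ℂ} (hμ : 0 < μ.re ∨ μ = 0) :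
    DifferentiableAt ℂ (step q) μ := by
  have h := (spectrum.hasDerivAt_resolvent_const_left (mem_resolventSet (q := q) hμ)).differentiableAt
  exact h.clm_apply (differentiableAt_const _)

theorem re_pos_or_eq_zero {θ : ℝ} (hθ : |θ| < Real.pi / 2) {μ : ℂ} (hμ : μ ∈ closedSector θ) :
    0 < μ.re ∨ μ = 0 := by
  rcases eq_or_ne μ 0 with h | h
  · exact Or.inr h
  · exact Or.inl (re_pos_of_mem_closedSector hθ hμ h)

theorem exists_norm_step_le (q : ℕ) {θ : ℝ} (hθ : |θ| < Real.pi / 2) :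
    ∃ C : ℝ, 0 < C ∧ ∀ μ ∈ closedSector θ, ‖step q μ‖ ≤ C / (1 + ‖μ‖) := by
  have hcl : IsClosed (closedSector θ) :=
    isClosed_le (continuous_const.mul continuous_norm) Complex.continuous_re
  obtain ⟨C₁, hC₁⟩ := ((isCompact_closedBall (0 : ℂ) (2 * ‖transportOp q‖ + 1)).inter_left
    hcl).exists_bound_of_continuousOn (f := step q)
    (fun μ hμ => (differentiableAt_step (re_pos_or_eq_zero hθ hμ.1)).continuousAt.continuousWithinAt)
  refine ⟨|C₁| * (2 + 2 * ‖transportOp q‖) + 4 * ‖evalRep q‖ + 1, by positivity, fun μ hμ => ?_⟩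
  rw [le_div_iff₀ (by positivity)]
  -- Bounded `μ` are handled by continuity on a compact set; beyond that radius the term with `S` in
  -- `(μ + S) p = ℓ` is absorbed on the left.
  rcases le_total ‖μ‖ (2 * ‖transportOp q‖ + 1) with h | h
  · have h1 := hC₁ μ ⟨hμ, by simpa using h⟩
    calc ‖step q μ‖ * (1 + ‖μ‖) ≤ |C₁| * (2 + 2 * ‖transportOp q‖) := by
          exact mul_le_mul (h1.trans (le_abs_self _)) (by linarith) (by positivity) (abs_nonneg _)
      _ ≤ _ := by linarith [norm_nonneg (evalRep q)]
  · have h1 : ‖μ‖ * ‖step q μ‖ ≤ ‖evalRep q‖ + ‖transportOp q‖ * ‖step q μ‖ := by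
      rw [← norm_smul, eq_sub_of_add_eq (smul_step_add (re_pos_or_eq_zero hθ hμ))]
      exact (norm_sub_le _ _).trans (add_le_add le_rfl ((transportOp q).le_opNorm _))
    have h2 := norm_nonneg (step q μ)
    have h3 := norm_nonneg (transportOp q)
    have h4 : 0 ≤ |C₁| * (2 + 2 * ‖transportOp q‖) := by positivity
    nlinarith

/-- The energy identity gives `|r|² (1 + δ|μ|) ≤ 1`: constant 1, but only the power `-1/2` at
infinity. The bound on `step` gives `|r| ≤ D / (1 + |μ|)`: the right power, but a constant that may
exceed 1. The first is used for `|μ| ≤ 2D`, the second for `|μ| ≥ 2D`. -/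
theorem exists_norm_ev_one_step_le (q : ℕ) {θ : ℝ} (hθ : |θ| < Real.pi / 2) :
    ∃ c : ℝ, 0 < c ∧ c ≤ 1 ∧ ∀ μ ∈ closedSector θ, ‖ev 1 (step q μ)‖ ≤ (1 + c * ‖μ‖)⁻¹ := by
  obtain ⟨C₁, hC₁, h₁⟩ := exists_norm_sq_le_integral q
  obtain ⟨C₂, hC₂, h₂⟩ := exists_norm_step_le q hθ
  have hcos := Real.cos_pos_of_mem_Ioo ⟨(abs_lt.1 hθ).1, (abs_lt.1 hθ).2⟩
  set D : ℝ := (q + 1) * C₂ + 1 with hD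
  have hD1 : 1 ≤ D := by rw [hD]; linarith [show 0 ≤ (q + 1 : ℝ) * C₂ by positivity]
  set δ : ℝ := 2 * Real.cos θ / ((q + 1) ^ 2 * C₁) with hδ
  have hδ0 : 0 < δ := by positivity
  have hdecay : ∀ μ ∈ closedSector θ, ‖ev 1 (step q μ)‖ ^ 2 * (1 + δ * ‖μ‖) ≤ 1 := by
    intro μ hμ
    have he := (isStep_step (q := q) (re_pos_or_eq_zero hθ hμ)).energy
    have h3 := h₁ (step q μ)
    have h4 := norm_ev_le (t := 1) (by simp) (step q μ)
    have h5 : ‖ev 1 (step q μ)‖ ^ 2 ≤ ((q + 1) ^ 2 * C₁) *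
        ∫ t in (0 : ℝ)..1, ‖ev t (step q μ)‖ ^ 2 := by
      calc _ ≤ ((q + 1) * ‖step q μ‖) ^ 2 := by gcongr
        _ = (q + 1) ^ 2 * ‖step q μ‖ ^ 2 := by ring
        _ ≤ (q + 1) ^ 2 * (C₁ * ∫ t in (0 : ℝ)..1, ‖ev t (step q μ)‖ ^ 2) := by gcongr
        _ = _ := by ring
    have h6 : ‖ev 1 (step q μ)‖ ^ 2 * (δ * ‖μ‖) ≤
        2 * μ.re * ∫ t in (0 : ℝ)..1, ‖ev t (step q μ)‖ ^ 2 := by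
      have hI := integral_sq_nonneg (step q μ)
      have hμ' : Real.cos θ * ‖μ‖ ≤ μ.re := hμ
      calc _ ≤ (((q + 1) ^ 2 * C₁) * ∫ t in (0 : ℝ)..1, ‖ev t (step q μ)‖ ^ 2) * (δ * ‖μ‖) := by
            gcongr
        _ = 2 * (Real.cos θ * ‖μ‖) * ∫ t in (0 : ℝ)..1, ‖ev t (step q μ)‖ ^ 2 := by
            rw [hδ]; field_simp
        _ ≤ _ := by gcongr
    rw [norm_one, one_pow] at he
    nlinarith [sq_nonneg ‖ev 0 (step q μ) - 1‖]
  -- The bound `1/(2D)` gives `D (1 + c|μ|) ≤ 1 + |μ|` for `|μ| ≥ 2D`; the bounds `1` and `δ/(2 +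
  -- 2D)` give `(1 + c|μ|)² ≤ 1 + δ|μ|` for `|μ| ≤ 2D`.
  refine ⟨min (1 / (2 * D)) (min 1 (δ / (2 + 2 * D))), by positivity,
    (min_le_right _ _).trans (min_le_left _ _), fun μ hμ => ?_⟩
  set c := min (1 / (2 * D)) (min 1 (δ / (2 + 2 * D))) with hc
  have c0 : 0 < c := by positivity
  have c1 : c * (2 * D) ≤ 1 := by
    rw [← le_div_iff₀ (by positivity)]; exact min_le_left _ _
  have c2 : c ≤ 1 := (min_le_right _ _).trans (min_le_left _ _)
  have c3 : c * (2 + 2 * D) ≤ δ := by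
    rw [← le_div_iff₀ (by positivity)]; exact (min_le_right _ _).trans (min_le_right _ _)
  have hμ0 := norm_nonneg μ
  rcases le_total ‖μ‖ (2 * D) with h | h
  · rw [← one_div, le_div_iff₀ (by positivity)]
    refine abs_le_of_sq_le_sq' ?_ zero_le_one |>.2
    refine le_trans ?_ ((hdecay μ hμ).trans_eq (one_pow 2).symm)
    rw [mul_pow]
    refine mul_le_mul_of_nonneg_left ?_ (sq_nonneg _)
    have : c * (c * ‖μ‖) ≤ c * (2 * D) := by
      refine mul_le_mul_of_nonneg_left ?_ c0.le
      nlinarith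
    nlinarith
  · have h3 := norm_ev_le (t := 1) (by simp) (step q μ)
    have h4 := h₂ μ hμ
    rw [le_div_iff₀ (by positivity)] at h4
    rw [← one_div, le_div_iff₀ (by positivity)]
    have h5 : ‖ev 1 (step q μ)‖ * (1 + ‖μ‖) ≤ D := by
      calc _ ≤ ((q + 1) * ‖step q μ‖) * (1 + ‖μ‖) := by gcongr
        _ = (q + 1) * (‖step q μ‖ * (1 + ‖μ‖)) := by ring
        _ ≤ (q + 1) * C₂ := by gcongr
        _ ≤ D := by rw [hD]; linarith
    have h6 : D * (1 + c * ‖μ‖) ≤ 1 + ‖μ‖ := by nlinarith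
    have h7 : ‖ev 1 (step q μ)‖ * D * (1 + c * ‖μ‖) ≤ D := by
      refine le_trans ?_ h5
      rw [mul_assoc]
      gcongr
    have h8 : ‖ev 1 (step q μ)‖ * (1 + c * ‖μ‖) * D ≤ 1 * D := by linarith
    exact le_of_mul_le_mul_right h8 (by linarith)

end TimePoly

/-! ### Products over the time steps and the step ratio condition. -/

/-- Keep the elementary symmetric terms of degree at most 2 in the expanded product; the quadratic
one is `((∑ x)² - ∑ x²) / 2`. The first two conjuncts feed the induction. -/
theorem one_add_sq_sum_le_prod (x : ℕ → ℝ) (s : Finset ℕ) (hx : ∀ j ∈ s, 0 ≤ x j) :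
    0 ≤ ∑ j ∈ s, x j ∧ ∑ j ∈ s, x j ^ 2 ≤ (∑ j ∈ s, x j) ^ 2 ∧
    1 + ∑ j ∈ s, x j + ((∑ j ∈ s, x j) ^ 2 - ∑ j ∈ s, x j ^ 2) / 2 ≤ ∏ j ∈ s, (1 + x j) := by
  induction s using Finset.cons_induction with
  | empty => simp
  | cons a s ha ih =>
    obtain ⟨h1, h2, h3⟩ := ih fun j hj => hx j (Finset.mem_cons_of_mem hj)
    have h0 := hx a (Finset.mem_cons_self a s)
    simp only [Finset.sum_cons, Finset.prod_cons]
    refine ⟨by positivity, by nlinarith [mul_nonneg h0 h1], ?_⟩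
    nlinarith [mul_le_mul_of_nonneg_left h3 (show 0 ≤ 1 + x a by linarith),
      mul_nonneg h0 (sub_nonneg.2 h2)]

theorem DGFE.TimeMesh.step_pos {T : ℝ} {M : ℕ} (τ : TimeMesh T M) {m : ℕ} (h1 : 1 ≤ m)
    (h2 : m ≤ M) : 0 < τ.step m := by
  obtain ⟨n, rfl⟩ : ∃ n, m = n + 1 := ⟨m - 1, by omega⟩
  exact sub_pos.2 (τ.node_lt n (by omega))

theorem DGFE.TimeMesh.sum_step {T : ℝ} {M : ℕ} (τ : TimeMesh T M) (m : ℕ) :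
    ∑ j ∈ Finset.Icc 1 m, τ.step j = τ.node m := by
  induction m with
  | zero => simp [τ.node_zero]
  | succ n ih => rw [Finset.sum_Icc_succ_top (by omega), ih, TimeMesh.step, Nat.add_sub_cancel]; ring

theorem DGFE.TimeMesh.node_pos {T : ℝ} {M : ℕ} (τ : TimeMesh T M) {m : ℕ} (h1 : 1 ≤ m)
    (h2 : m ≤ M) : 0 < τ.node m := by
  rw [← τ.sum_step]
  refine Finset.sum_pos (fun j hj => ?_) ⟨1, by simpa using h1⟩
  rw [Finset.mem_Icc] at hj
  exact τ.step_pos hj.1 (hj.2.trans h2)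

/-- A step is at most `κ` times some neighbouring step inside `[0, t_m]`, and the two together do
not exceed `t_m`. The neighbour is the right one for `j < m` and the left one for `j = m`, so `m ≥
2` is needed. -/
theorem DGFE.TimeMesh.RatioBounded.step_le {T : ℝ} {M : ℕ} {τ : TimeMesh T M} {κ : ℝ}
    (h : τ.RatioBounded κ) (hκ : 0 < κ) {m : ℕ} (hm : 2 ≤ m) (hmM : m ≤ M) {j : ℕ} (hj : 1 ≤ j)
    (hjm : j ≤ m) : τ.step j * (1 + κ) ≤ κ * τ.node m := by
  have hpos : ∀ i ∈ Finset.Icc 1 m, 0 < τ.step i := fun i hi => by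
    rw [Finset.mem_Icc] at hi
    exact τ.step_pos hi.1 (hi.2.trans hmM)
  obtain ⟨i, hi1, him, hij, hle⟩ : ∃ i, 1 ≤ i ∧ i ≤ m ∧ i ≠ j ∧ τ.step j ≤ κ * τ.step i := by
    rcases hjm.lt_or_eq with hlt | rfl
    · refine ⟨j + 1, by omega, by omega, by omega, ?_⟩
      have := (h j hj (by omega)).2
      rwa [div_le_iff₀ (τ.step_pos (by omega) (by omega))] at this
    · refine ⟨j - 1, by omega, by omega, by omega, ?_⟩
      have := (h (j - 1) (by omega) (by omega)).1
      rw [Nat.sub_add_cancel hj, inv_eq_one_div,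
        div_le_div_iff₀ hκ (τ.step_pos (by omega) (by omega))] at this
      linarith
  have hsum : τ.step j + τ.step i ≤ τ.node m := by
    rw [← τ.sum_step, ← Finset.sum_pair (f := τ.step) hij.symm]
    refine Finset.sum_le_sum_of_subset_of_nonneg ?_ fun l hl _ => (hpos l hl).le
    intro l hl
    simp only [Finset.mem_insert, Finset.mem_singleton] at hl
    rw [Finset.mem_Icc]
    rcases hl with rfl | rfl <;> omega
  nlinarith

/-- Since no step exceeds `κ/(1 + κ) t_m`, also `∑ k_j² ≤ κ/(1 + κ) t_m²`, and a fixed fraction of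
`t_m²` survives in the quadratic symmetric term. -/
theorem DGFE.TimeMesh.RatioBounded.one_add_sq_le_prod {T : ℝ} {M : ℕ} {τ : TimeMesh T M} {κ : ℝ}
    (h : τ.RatioBounded κ) (hκ : 0 < κ) {m : ℕ} (hm : 2 ≤ m) (hmM : m ≤ M) {y : ℝ} (hy : 0 ≤ y) :
    1 + (y * τ.node m) ^ 2 / (2 * (1 + κ)) ≤ ∏ j ∈ Finset.Icc 1 m, (1 + y * τ.step j) := by
  have hpos : ∀ i ∈ Finset.Icc 1 m, 0 < τ.step i := fun i hi => by
    rw [Finset.mem_Icc] at hi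
    exact τ.step_pos hi.1 (hi.2.trans hmM)
  obtain ⟨h1, -, h3⟩ := one_add_sq_sum_le_prod (fun j => y * τ.step j) (Finset.Icc 1 m)
    fun j hj => mul_nonneg hy (hpos j hj).le
  rw [← Finset.mul_sum, τ.sum_step] at h1 h3
  have hQ : ∑ j ∈ Finset.Icc 1 m, (y * τ.step j) ^ 2 ≤ κ / (1 + κ) * (y * τ.node m) ^ 2 := by
    calc _ ≤ ∑ j ∈ Finset.Icc 1 m, (y ^ 2 * (κ / (1 + κ) * τ.node m)) * τ.step j := by
          refine Finset.sum_le_sum fun j hj => ?_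
          have h4 := hpos j hj
          rw [Finset.mem_Icc] at hj
          have h5 : τ.step j ≤ κ / (1 + κ) * τ.node m := by
            rw [div_mul_eq_mul_div, le_div_iff₀ (by positivity)]
            exact h.step_le hκ hm hmM hj.1 hj.2
          calc (y * τ.step j) ^ 2 = y ^ 2 * τ.step j * τ.step j := by ring
            _ ≤ _ := by gcongr
      _ = _ := by rw [← Finset.mul_sum, τ.sum_step]; ring
  have e : (y * τ.node m) ^ 2 / (2 * (1 + κ)) =
      ((y * τ.node m) ^ 2 - κ / (1 + κ) * (y * τ.node m) ^ 2) / 2 := by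
    field_simp; ring
  rw [e]
  linarith

/-! ### Decay of the symbols. -/

namespace TimePoly

variable {q : ℕ}

theorem ofReal_mul_mem_closedSector {θ : ℝ} {k : ℝ} (hk : 0 ≤ k) {z : ℂ}
    (hz : z ∈ closedSector θ) : (k : ℂ) * z ∈ closedSector θ := by
  simp only [closedSector, Set.mem_ofPred_eq, norm_mul, Complex.norm_real, Complex.re_ofReal_mul,
    Real.norm_of_nonneg hk] at hz ⊢
  nlinarith [mul_le_mul_of_nonneg_left hz hk]

theorem differentiableAt_step_mul {k : ℝ} (hk : 0 < k) {z : ℂ} (hz : 0 < z.re) :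
    DifferentiableAt ℂ (fun z => step q (k * z)) z := by
  refine DifferentiableAt.comp (g := step q) (f := fun z : ℂ => (k : ℂ) * z) z ?_ (by fun_prop)
  exact differentiableAt_step (Or.inl (by rw [Complex.re_ofReal_mul]; positivity))

/-- The symbol `z L(p(k_m z)) r(k_{m-1} z) ⋯ r(k_1 z)` of a functional of the dG solution on the
`m`-th interval. -/
noncomputable def symbol {T : ℝ} {M : ℕ} (τ : TimeMesh T M) (L : TimePoly q →L[ℂ] ℂ) (m : ℕ)
    (z : ℂ) : ℂ :=
  z * (L (step q (τ.step m * z)) * ∏ j ∈ Finset.Ico 1 m, ev 1 (step q (τ.step j * z)))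

theorem differentiableAt_ev_one_step_mul {k : ℝ} (hk : 0 < k) {z : ℂ} (hz : 0 < z.re) :
    DifferentiableAt ℂ (fun z => ev 1 (step q (k * z))) z :=
  (LinearMap.toContinuousLinearMap (ev (q := q) 1)).differentiableAt.comp z
    (differentiableAt_step_mul hk hz)

theorem differentiableAt_symbol {T : ℝ} {M : ℕ} (τ : TimeMesh T M) (L : TimePoly q →L[ℂ] ℂ) {m : ℕ}
    (h1 : 1 ≤ m) (hmM : m ≤ M) {z : ℂ} (hz : 0 < z.re) :
    DifferentiableAt ℂ (symbol τ L m) z := by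
  refine differentiableAt_id.mul (DifferentiableAt.mul ?_ ?_)
  · exact L.differentiableAt.comp z (differentiableAt_step_mul (τ.step_pos h1 hmM) hz)
  · refine DifferentiableAt.fun_finsetProd fun j hj => ?_
    rw [Finset.mem_Ico] at hj
    exact differentiableAt_ev_one_step_mul (τ.step_pos hj.1 (by omega)) hz

theorem exists_sectorDecay_symbol (q : ℕ) {θ : ℝ} (hθ : |θ| < Real.pi / 2) {κ : ℝ} (hκ : 0 < κ) :
    ∃ A B : ℝ, 0 < A ∧ 0 < B ∧ ∀ (T : ℝ) (M : ℕ) (τ : TimeMesh T M), τ.RatioBounded κ →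
      ∀ (L : TimePoly q →L[ℂ] ℂ) (m : ℕ), 2 ≤ m → m ≤ M →
        SectorDecay θ (A * τ.node m) (B * ‖L‖) (symbol τ L m) := by
  obtain ⟨C, hC, hstep⟩ := exists_norm_step_le q hθ
  obtain ⟨c, hc0, hc1, hr⟩ := exists_norm_ev_one_step_le q hθ
  -- Chosen so that `(A t_m |z|)²` is exactly the quadratic term of the product bound with `y =
  -- c|z|`.
  refine ⟨c / Real.sqrt (2 * (1 + κ)), C, by positivity, hC, fun T M τ hτ L m hm hmM => ?_⟩
  refine ⟨fun z hz => (differentiableAt_symbol τ L (by omega) hmM hz).differentiableWithinAt,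
    by simp [symbol], fun z hz => ?_⟩
  have hk : ∀ j, 1 ≤ j → j ≤ m → 0 < τ.step j := fun j h1 h2 => τ.step_pos h1 (h2.trans hmM)
  have b1 : ‖L (step q (τ.step m * z))‖ ≤ ‖L‖ * (C * (1 + c * ‖z‖ * τ.step m)⁻¹) := by
    have hkm := hk m (by omega) le_rfl
    refine (L.le_opNorm _).trans (mul_le_mul_of_nonneg_left ?_ (norm_nonneg _))
    refine (hstep _ (ofReal_mul_mem_closedSector hkm.le hz)).trans ?_
    rw [div_eq_mul_inv, norm_mul, Complex.norm_real, Real.norm_of_nonneg hkm.le]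
    refine mul_le_mul_of_nonneg_left (inv_anti₀ (by positivity) ?_) hC.le
    -- Uses `c ≤ 1`: weakening the decay of `step` to the rate `c` makes it the missing factor `j =
    -- m` of the product.
    nlinarith [mul_nonneg (norm_nonneg z) hkm.le]
  have b2 : ‖∏ j ∈ Finset.Ico 1 m, ev 1 (step q (τ.step j * z))‖ ≤
      ∏ j ∈ Finset.Ico 1 m, (1 + c * ‖z‖ * τ.step j)⁻¹ := by
    rw [norm_prod]
    refine Finset.prod_le_prod (fun _ _ => norm_nonneg _) fun j hj => ?_
    rw [Finset.mem_Ico] at hj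
    have hkj := hk j hj.1 (by omega)
    refine (hr _ (ofReal_mul_mem_closedSector hkj.le hz)).trans (le_of_eq ?_)
    rw [norm_mul, Complex.norm_real, Real.norm_of_nonneg hkj.le]
    ring
  have b3 := hτ.one_add_sq_le_prod hκ hm hmM (y := c * ‖z‖) (by positivity)
  have e : ∏ j ∈ Finset.Icc 1 m, (1 + c * ‖z‖ * τ.step j) =
      (1 + c * ‖z‖ * τ.step m) * ∏ j ∈ Finset.Ico 1 m, (1 + c * ‖z‖ * τ.step j) := by
    rw [← Finset.Ico_insert_right (show 1 ≤ m by omega), Finset.prod_insert (by simp)]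
  have e2 : (c / Real.sqrt (2 * (1 + κ)) * τ.node m * ‖z‖) ^ 2 =
      (c * ‖z‖ * τ.node m) ^ 2 / (2 * (1 + κ)) := by
    rw [mul_pow, mul_pow, div_pow, Real.sq_sqrt (by positivity)]
    ring
  rw [symbol, norm_mul, norm_mul, e2]
  have hkm := hk m (by omega) le_rfl
  have hprod : 0 ≤ ∏ j ∈ Finset.Ico 1 m, (1 + c * ‖z‖ * τ.step j)⁻¹ :=
    (norm_nonneg _).trans b2
  calc _ ≤ ‖z‖ * (‖L‖ * (C * (1 + c * ‖z‖ * τ.step m)⁻¹) *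
        ∏ j ∈ Finset.Ico 1 m, (1 + c * ‖z‖ * τ.step j)⁻¹) := by gcongr
    _ = C * ‖L‖ * (‖z‖ * (∏ j ∈ Finset.Icc 1 m, (1 + c * ‖z‖ * τ.step j))⁻¹) := by
        rw [e, mul_inv, Finset.prod_inv_distrib]; ring
    _ ≤ C * ‖L‖ * (‖z‖ * (1 + (c * ‖z‖ * τ.node m) ^ 2 / (2 * (1 + κ)))⁻¹) := by
        gcongr
    _ = _ := by rw [div_eq_mul_inv ‖z‖]

/-- On the first interval `step` decays only to first order. From `ℓ = μ p + S p` follows `p - ℓ/(1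
+ μ) = (p - S p)/(1 + μ)`, which gains the second order. -/
theorem exists_sectorDecay_symbol_one (q : ℕ) {θ : ℝ} (hθ : |θ| < Real.pi / 2) :
    ∃ B : ℝ, 0 < B ∧ ∀ (L : TimePoly q →L[ℂ] ℂ) (k : ℝ), 0 < k →
      SectorDecay θ k (B * ‖L‖)
        (fun z => z * (L (step q (k * z)) - L (evalRep q) / (1 + k * z))) := by
  obtain ⟨C, hC, hstep⟩ := exists_norm_step_le q hθ
  refine ⟨(1 + ‖transportOp q‖) * C * 2, by positivity, fun L k hk => ⟨?_, by simp, ?_⟩⟩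
  · intro z hz
    refine DifferentiableAt.differentiableWithinAt ?_
    refine differentiableAt_id.mul (DifferentiableAt.sub ?_ ?_)
    · exact L.differentiableAt.comp z (differentiableAt_step_mul hk hz)
    · refine (differentiableAt_const _).div (by fun_prop) fun h => ?_
      have := congrArg Complex.re h
      simp only [Complex.add_re, Complex.one_re, Complex.re_ofReal_mul, Complex.zero_re] at this
      have hz' : 0 < z.re := hz
      nlinarith
  · intro z hz
    have hμ := ofReal_mul_mem_closedSector hk.le hz
    have hkz : ‖(k : ℂ) * z‖ = k * ‖z‖ := by
      rw [norm_mul, Complex.norm_real, Real.norm_of_nonneg hk.le]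
    set μ : ℂ := k * z with hμd
    have hre : 0 ≤ μ.re := by
      rcases re_pos_or_eq_zero hθ hμ with h | h
      · exact h.le
      · simp [h]
    obtain ⟨n1, n2⟩ := norm_le_norm_ofReal_add hre zero_le_one
    rw [Complex.ofReal_one] at n1 n2
    have hne : 1 + μ ≠ 0 := by rw [← norm_pos_iff]; linarith
    have e1 : L (step q μ) - L (evalRep q) / (1 + μ) =
        L (step q μ - transportOp q (step q μ)) / (1 + μ) := by
      have := smul_step_add (q := q) (re_pos_or_eq_zero hθ hμ)
      rw [← this, map_add, map_sub, map_smul, smul_eq_mul]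
      field_simp
      ring
    have b1 : ‖L (step q μ - transportOp q (step q μ))‖ ≤
        ‖L‖ * ((1 + ‖transportOp q‖) * (C / (1 + ‖μ‖))) := by
      refine (L.le_opNorm _).trans (mul_le_mul_of_nonneg_left ?_ (norm_nonneg _))
      refine (norm_sub_le _ _).trans ?_
      have h1 := (transportOp q).le_opNorm (step q μ)
      have h2 := hstep μ hμ
      calc _ ≤ ‖step q μ‖ + ‖transportOp q‖ * ‖step q μ‖ := by gcongr
        _ = (1 + ‖transportOp q‖) * ‖step q μ‖ := by ring
        _ ≤ _ := by gcongr
    rw [norm_mul, e1, norm_div]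
    have hz0 := norm_nonneg z
    have b2 : (1 + ‖μ‖)⁻¹ * ‖1 + μ‖⁻¹ ≤ 2 * (1 + (k * ‖z‖) ^ 2)⁻¹ := by
      rw [← mul_inv, ← hkz]
      have : ((1 + ‖μ‖ ^ 2) / 2)⁻¹ = 2 * (1 + ‖μ‖ ^ 2)⁻¹ := by field_simp
      rw [← this]
      refine inv_anti₀ (by positivity) ?_
      nlinarith [norm_nonneg μ]
    calc _ ≤ ‖z‖ * (‖L‖ * ((1 + ‖transportOp q‖) * (C / (1 + ‖μ‖))) / ‖1 + μ‖) := by gcongr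
      _ = ‖z‖ * (‖L‖ * ((1 + ‖transportOp q‖) * C)) * ((1 + ‖μ‖)⁻¹ * ‖1 + μ‖⁻¹) := by
          rw [div_eq_mul_inv, div_eq_mul_inv]; ring
      _ ≤ ‖z‖ * (‖L‖ * ((1 + ‖transportOp q‖) * C)) * (2 * (1 + (k * ‖z‖) ^ 2)⁻¹) := by gcongr
      _ = _ := by rw [div_eq_mul_inv ‖z‖]; ring

end TimePoly

/-! ### Seminorm estimates for functions of a diagonal operator -/

section Diagonal

variable {W ι : Type*} [AddCommGroup W] [Module ℂ W] {A : Module.End ℂ W}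
  {b : Module.Basis ι ℂ W} {lam : ι → ℝ}

theorem resolvent_apply_basis (hA : ∀ i, A (b i) = (lam i : ℂ) • b i) {z : ℂ}
    (hz : ∀ i, z - lam i ≠ 0) (i : ι) : resolvent A z (b i) = (z - lam i)⁻¹ • b i := by
  set R : Module.End ℂ W := b.constr ℂ fun i => (z - lam i)⁻¹ • b i with hR
  have hRb : ∀ i, R (b i) = (z - lam i)⁻¹ • b i := fun i => b.constr_basis ℂ _ i
  have hS : ∀ i, (algebraMap ℂ (Module.End ℂ W) z - A) (b i) = (z - lam i) • b i := by
    intro i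
    rw [LinearMap.sub_apply, hA, Module.algebraMap_end_apply, sub_smul]
  have h1 : (algebraMap ℂ (Module.End ℂ W) z - A) * R = 1 := by
    refine b.ext fun i => ?_
    rw [Module.End.mul_apply, hRb, map_smul, hS, smul_smul, inv_mul_cancel₀ (hz i), one_smul,
      Module.End.one_apply]
  have h2 : R * (algebraMap ℂ (Module.End ℂ W) z - A) = 1 := by
    refine b.ext fun i => ?_
    rw [Module.End.mul_apply, hS, map_smul, hRb, smul_smul, mul_inv_cancel₀ (hz i), one_smul,
      Module.End.one_apply]
  have h3 : resolvent A z = R := by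
    rw [resolvent]
    exact Ring.inverse_unit ⟨_, R, h1, h2⟩
  rw [h3, hRb]

theorem resolvent_apply_sum [Fintype ι] (hA : ∀ i, A (b i) = (lam i : ℂ) • b i) {z : ℂ}
    (hz : ∀ i, z - lam i ≠ 0) (c : ι → ℂ) :
    resolvent A z (∑ i, c i • b i) = ∑ i, ((z - lam i)⁻¹ * c i) • b i := by
  rw [map_sum]
  refine Finset.sum_congr rfl fun i _ => ?_
  rw [map_smul, resolvent_apply_basis hA hz, smul_smul, mul_comm]

/-- The scalar Cauchy formula, applied in each eigencoordinate, assembles to a contour integral of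
resolvents. The norm is taken only inside that integral, so the constant sees neither the basis nor
the dimension: two rays, mass `π/(2a)` each, divided by `2π`. -/
theorem norm_sum_apply_le_of_sectorDecay [Fintype ι] {E : Type*} [NormedAddCommGroup E]
    [NormedSpace ℂ E] [CompleteSpace E] {A : Module.End ℂ E} {b : Module.Basis ι ℂ E}
    (hA : ∀ i, A (b i) = (lam i : ℂ) • b i) (hlam : ∀ i, 0 ≤ lam i) {γ θ : ℝ}
    (hγ0 : 0 < γ) (hγ : γ < θ) (hθ : θ < Real.pi / 2) {Mh : ℝ}
    (hM : ∀ z : ℂ, z ∉ sector γ → ∀ χ : E, ‖resolvent A z χ‖ ≤ Mh / ‖z‖ * ‖χ‖) {a B : ℝ} {F : ℂ → ℂ}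
    (ha : 0 < a) (hF : SectorDecay θ a B F) (c : ι → ℂ) :
    ‖∑ i, (F (lam i) * c i) • b i‖ ≤ B * Mh / (2 * a) * ‖∑ i, c i • b i‖ := by
  have h0 : 0 < θ := hγ0.trans hγ
  have a1 : |θ| ≤ θ := by rw [abs_of_pos h0]
  have a2 : |-θ| ≤ θ := by rw [abs_neg, abs_of_pos h0]
  have hne : ∀ y, |y| ≤ θ → y ≠ 0 → ∀ x i, rayPoint y x - lam i ≠ 0 := fun y hy hy0 x i =>
    rayPoint_sub_ne_zero hy0 (hy.trans_lt hθ) x _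
  set v := ∑ i, c i • b i with hv
  -- The extra factor `rayPoint y x` is `dz/dx`; it compensates the `1/|z|` of the resolvent
  -- estimate.
  set g : ℝ → ℝ → E := fun y x => F (rayPoint y x) • rayPoint y x • resolvent A (rayPoint y x) v
    with hg
  have hgsum : ∀ y, |y| ≤ θ → y ≠ 0 → ∀ x, g y x =
      ∑ i, (F (rayPoint y x) * (rayPoint y x / (rayPoint y x - lam i))) • c i • b i := by
    intro y hy hy0 x
    simp only [hg, hv]
    rw [resolvent_apply_sum hA (hne y hy hy0 x), Finset.smul_sum, Finset.smul_sum]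
    refine Finset.sum_congr rfl fun i _ => ?_
    rw [smul_smul, smul_smul, smul_smul]
    congr 1
    rw [div_eq_mul_inv]
    ring
  have hgint : ∫ x, (g θ x - g (-θ) x) =
      -(2 * Real.pi * Complex.I) • ∑ i, (F (lam i) * c i) • b i := by
    have e : ∀ x, g θ x - g (-θ) x = ∑ i,
        (F (rayPoint θ x) * (rayPoint θ x / (rayPoint θ x - lam i)) -
        F (rayPoint (-θ) x) * (rayPoint (-θ) x / (rayPoint (-θ) x - lam i))) • c i • b i := by
      intro x
      rw [hgsum θ a1 h0.ne', hgsum (-θ) a2 (neg_ne_zero.2 h0.ne'), ← Finset.sum_sub_distrib]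
      exact Finset.sum_congr rfl fun i _ => (sub_smul _ _ _).symm
    simp_rw [e]
    have hint : ∀ i, Integrable fun x =>
        F (rayPoint θ x) * (rayPoint θ x / (rayPoint θ x - lam i)) -
        F (rayPoint (-θ) x) * (rayPoint (-θ) x / (rayPoint (-θ) x - lam i)) := fun i =>
      (hF.integrable_kernel ha hθ h0.ne' a1 (lam i)).sub
        (hF.integrable_kernel ha hθ (neg_ne_zero.2 h0.ne') a2 (lam i))
    rw [integral_finsetSum _ fun i _ => (hint i).smul_const _, Finset.smul_sum]
    refine Finset.sum_congr rfl fun i _ => ?_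
    rw [integral_smul_const, hF.integral_kernel ha h0 hθ (hlam i), smul_smul, smul_smul]
    ring_nf
  have hgb : ∀ y, |y| ≤ θ → γ < |y| → ∀ x, ‖g y x‖ ≤ B * expWeight a x * (Mh * ‖v‖) := by
    intro y hy hy0 x
    have h1 := hM _ (rayPoint_notMem_sector hy0 (hy.trans_lt hθ) x) v
    have h2 := hF.bound_rayPoint hθ hy x
    have h3 := norm_pos_iff.2 (rayPoint_ne_zero y x)
    simp only [hg]
    rw [norm_smul, norm_smul]
    refine mul_le_mul h2 ?_ (by positivity) ((norm_nonneg _).trans h2)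
    calc _ ≤ ‖rayPoint y x‖ * (Mh / ‖rayPoint y x‖ * ‖v‖) := by gcongr
      _ = _ := by field_simp
  have hbound := norm_integral_le_of_norm_le (f := fun x => g θ x - g (-θ) x)
    ((integrable_expWeight ha).const_mul (2 * B * (Mh * ‖v‖)))
    (Eventually.of_forall fun x => by
      have h1 := hgb θ a1 (by rw [abs_of_pos h0]; exact hγ) x
      have h2 := hgb (-θ) a2 (by rw [abs_neg, abs_of_pos h0]; exact hγ) x
      refine (norm_sub_le _ _).trans ?_
      linarith)
  rw [hgint, integral_const_mul, integral_expWeight ha, norm_smul] at hbound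
  have hpi := Real.pi_pos
  have e3 : ‖(-(2 * Real.pi * Complex.I) : ℂ)‖ = 2 * Real.pi := by
    simp [abs_of_pos hpi]
  rw [e3] at hbound
  have e4 : 2 * B * (Mh * ‖v‖) * (a⁻¹ * (Real.pi / 2)) =
      2 * Real.pi * (B * Mh / (2 * a) * ‖v‖) := by
    field_simp
  rw [e4] at hbound
  exact le_of_mul_le_mul_left hbound (by positivity)

/-- A definite seminorm as a norm. -/
@[reducible] noncomputable def Seminorm.toNormedAddCommGroup' (N : Seminorm ℂ W)
    (hN : ∀ v, N v = 0 → v = 0) : NormedAddCommGroup W :=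
  letI : Norm W := ⟨N⟩
  NormedAddCommGroup.ofCore (𝕜 := ℂ)
    { norm_nonneg := fun v => apply_nonneg N v
      norm_smul := fun c v => map_smul_eq_mul N c v
      norm_triangle := fun v w => map_add_le_add N v w
      norm_eq_zero_iff := fun v => ⟨hN v, fun h => by rw [h]; exact map_zero N⟩ }

theorem Seminorm.sum_apply_le_of_sectorDecay [Fintype ι] {N : Seminorm ℂ W}
    (hN : ∀ v, N v = 0 → v = 0) (hA : ∀ i, A (b i) = (lam i : ℂ) • b i) (hlam : ∀ i, 0 ≤ lam i) {γ θ : ℝ}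
    (hγ0 : 0 < γ) (hγ : γ < θ) (hθ : θ < Real.pi / 2) {Mh : ℝ}
    (hM : ∀ z : ℂ, z ∉ sector γ → ∀ χ : W, N (resolvent A z χ) ≤ Mh / ‖z‖ * N χ) {a B : ℝ}
    {F : ℂ → ℂ} (ha : 0 < a) (hF : SectorDecay θ a B F) (c : ι → ℂ) :
    N (∑ i, (F (lam i) * c i) • b i) ≤ B * Mh / (2 * a) * N (∑ i, c i • b i) := by
  -- The vector-valued integral is taken in the space normed by `N`, which is complete because it is
  -- finite dimensional.
  let := N.toNormedAddCommGroup' hN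
  let : NormedSpace ℂ W := { norm_smul_le := fun c v => (map_smul_eq_mul N c v).le }
  have : FiniteDimensional ℂ W := Module.Finite.of_basis b
  have : CompleteSpace W := FiniteDimensional.complete ℂ W
  exact norm_sum_apply_le_of_sectorDecay hA hlam hγ0 hγ hθ hM ha hF c

/-- With `z = -1/k`, whose argument `π` lies outside the sector, `(1 + k A)⁻¹ = z (z - A)⁻¹`, and
`|z|` cancels in the estimate. -/
theorem Seminorm.sum_inv_one_add_le [Fintype ι] {N : Seminorm ℂ W}
    (hA : ∀ i, A (b i) = (lam i : ℂ) • b i) (hlam : ∀ i, 0 ≤ lam i) {γ : ℝ}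
    (hγ : γ < Real.pi / 2) {Mh : ℝ}
    (hM : ∀ z : ℂ, z ∉ sector γ → ∀ χ : W, N (resolvent A z χ) ≤ Mh / ‖z‖ * N χ) {k : ℝ}
    (hk : 0 < k) (c : ι → ℂ) :
    N (∑ i, (((1 + k * lam i : ℝ) : ℂ)⁻¹ * c i) • b i) ≤ Mh * N (∑ i, c i • b i) := by
  set z : ℂ := ((-k⁻¹ : ℝ) : ℂ) with hz
  have hki : -k⁻¹ < 0 := neg_lt_zero.2 (inv_pos.2 hk)
  have hzs : z ∉ sector γ := by
    simp only [sector, Set.mem_ofPred_eq, hz, Complex.arg_ofReal_of_neg hki, abs_of_pos Real.pi_pos]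
    linarith [Real.pi_pos]
  have hne : ∀ i, z - lam i ≠ 0 := by
    intro i
    rw [hz, ← Complex.ofReal_sub]
    exact_mod_cast (by linarith [hlam i] : -k⁻¹ - lam i < 0).ne
  have h1 := hM z hzs (∑ i, c i • b i)
  have hnz : ‖z‖ = k⁻¹ := by
    rw [hz, Complex.norm_real, norm_neg, Real.norm_of_nonneg (inv_pos.2 hk).le]
  have e : ∑ i, (((1 + k * lam i : ℝ) : ℂ)⁻¹ * c i) • b i =
      z • resolvent A z (∑ i, c i • b i) := by
    rw [resolvent_apply_sum hA hne, Finset.smul_sum]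
    refine Finset.sum_congr rfl fun i _ => ?_
    rw [smul_smul, ← mul_assoc]
    congr 2
    have h2 : 0 < 1 + k * lam i := by nlinarith [mul_nonneg hk.le (hlam i)]
    have h3 : (-k⁻¹ - lam i : ℝ) ≠ 0 := by linarith [hlam i]
    rw [hz, ← Complex.ofReal_sub, ← Complex.ofReal_inv, ← Complex.ofReal_inv, ← Complex.ofReal_mul]
    congr 1
    rw [← div_eq_mul_inv, inv_eq_one_div, div_eq_div_iff h2.ne' h3]
    field_simp
    ring
  rw [e, map_smul_eq_mul, hnz]
  calc _ ≤ k⁻¹ * (Mh / ‖z‖ * N (∑ i, c i • b i)) := by gcongr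
    _ = _ := by rw [hnz]; field_simp

/-- Applied to an eigenvector, the bound for `(1 + k A)⁻¹` reads `(1 + k λ)⁻¹ ≤ M_h`; let `k → 0`.
It is used to absorb a bare `N v` into `M_h N v`. -/
theorem Seminorm.one_le_of_resolvent [Fintype ι] {N : Seminorm ℂ W}
    (hN : ∀ v, N v = 0 → v = 0) (hA : ∀ i, A (b i) = (lam i : ℂ) • b i) (hlam : ∀ i, 0 ≤ lam i) {γ : ℝ}
    (hγ : γ < Real.pi / 2) {Mh : ℝ}
    (hM : ∀ z : ℂ, z ∉ sector γ → ∀ χ : W, N (resolvent A z χ) ≤ Mh / ‖z‖ * N χ) (i : ι) :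
    1 ≤ Mh := by
  classical
  have hNi : 0 < N (b i) := lt_of_le_of_ne (apply_nonneg N _) fun h => b.ne_zero i (hN _ h.symm)
  have h1 : ∀ k : ℝ, 0 < k → (1 + k * lam i)⁻¹ ≤ Mh := by
    intro k hk
    have h2 := Seminorm.sum_inv_one_add_le (N := N) hA hlam hγ hM hk (Pi.single i 1)
    have h3 : 0 < 1 + k * lam i := by nlinarith [mul_nonneg hk.le (hlam i)]
    rw [Finset.sum_eq_single i (by intro j _ hj; simp [hj]) (by simp),
      Finset.sum_eq_single i (by intro j _ hj; simp [hj]) (by simp)] at h2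
    simp only [Pi.single_eq_same, mul_one, one_smul, map_smul_eq_mul, norm_inv, Complex.norm_real,
      Real.norm_of_nonneg h3.le] at h2
    exact le_of_mul_le_mul_right h2 hNi
  have h4 : Tendsto (fun k : ℝ => (1 + k * lam i)⁻¹) (𝓝[>] 0) (𝓝 1) := by
    have : ContinuousAt (fun k : ℝ => (1 + k * lam i)⁻¹) 0 := by
      refine ContinuousAt.inv₀ (by fun_prop) (by simp)
    have h5 := this.tendsto
    simp only [zero_mul, add_zero, inv_one] at h5
    exact h5.mono_left nhdsWithin_le_nhds
  exact le_of_tendsto h4 (eventually_mem_nhdsWithin.mono fun k hk => h1 k hk)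

end Diagonal

/-! ### Localization of the discontinuous Galerkin scheme -/

namespace TimePoly

theorem exists_ev_affine {q : ℕ} (p : TimePoly q) (α β : ℝ) :
    ∃ d : TimePoly q, ∀ t : ℝ, ev (α * t + β) p = ev t d := by
  set P : Polynomial ℂ := ∑ j : Fin (q + 1), Polynomial.monomial (j : ℕ) (p j) with hP
  have hPd : P.natDegree ≤ q := by
    refine Polynomial.natDegree_sum_le_of_forall_le _ _ fun j _ => ?_
    exact (Polynomial.natDegree_monomial_le _).trans (by omega)
  set Q : Polynomial ℂ := P.comp (Polynomial.C (α : ℂ) * Polynomial.X + Polynomial.C (β : ℂ))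
  have hQd : Q.natDegree ≤ q := by
    refine Polynomial.natDegree_comp_le.trans ?_
    calc _ ≤ q * 1 := Nat.mul_le_mul hPd (Polynomial.natDegree_linear_le)
      _ = q := mul_one q
  refine ⟨fun j => Q.coeff j, fun t => ?_⟩
  have h1 := Polynomial.eval_eq_sum_range' (p := Q) (n := q + 1) (by omega) (t : ℂ)
  rw [ev_apply, ev_apply]
  rw [Finset.sum_range] at h1
  have h2 : Q.eval (t : ℂ) = ∑ j : Fin (q + 1), ((α * t + β : ℝ) : ℂ) ^ (j : ℕ) * p j := by
    simp only [Q, hP, Polynomial.eval_comp, Polynomial.eval_finsetSum, Polynomial.eval_monomial,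
      Polynomial.eval_add, Polynomial.eval_mul, Polynomial.eval_C, Polynomial.eval_X,
      Complex.ofReal_add, Complex.ofReal_mul]
    exact Finset.sum_congr rfl fun j _ => mul_comm _ _
  rw [← h2, h1]
  exact Finset.sum_congr rfl fun j _ => mul_comm _ _

end TimePoly

namespace DGFE

section Mesh

variable {T : ℝ} {M : ℕ} (τ : TimeMesh T M)

theorem TimeMesh.node_mono {i j : ℕ} (hij : i ≤ j) (hj : j ≤ M) : τ.node i ≤ τ.node j := by
  induction j, hij using Nat.le_induction with
  | base => exact le_rfl
  | succ j _ ih => exact (ih (by omega)).trans (τ.node_lt j (by omega)).le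

theorem TimeMesh.notMem_interval {m m' : ℕ} (hne : m' ≠ m) (hm : m ≤ M) (hm' : m' ≤ M)
    {t : ℝ} (ht : t ∈ τ.interval m') : t ∉ τ.interval m := by
  intro ht'
  rcases lt_or_gt_of_ne hne with h | h
  · have := τ.node_mono (i := m') (j := m - 1) (by omega) (by omega)
    linarith [ht.2, ht'.1]
  · have := τ.node_mono (i := m) (j := m' - 1) (by omega) (by omega)
    linarith [ht.1, ht'.2]

/-- The affine coordinate on the `m`-th interval. -/
noncomputable def TimeMesh.coord (m : ℕ) (t : ℝ) : ℝ := (t - τ.node (m - 1)) / τ.step m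

theorem TimeMesh.coord_left (m : ℕ) : τ.coord m (τ.node (m - 1)) = 0 := by simp [TimeMesh.coord]

theorem TimeMesh.node_pred_lt {m : ℕ} (h1 : 1 ≤ m) (hmM : m ≤ M) : τ.node (m - 1) < τ.node m :=
  sub_pos.1 (τ.step_pos h1 hmM)

theorem TimeMesh.coord_right {m : ℕ} (h1 : 1 ≤ m) (hmM : m ≤ M) : τ.coord m (τ.node m) = 1 :=
  div_self (τ.step_pos h1 hmM).ne'

theorem TimeMesh.coord_mem {m : ℕ} (h1 : 1 ≤ m) (hmM : m ≤ M) {t : ℝ}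
    (ht : t ∈ τ.interval m) : τ.coord m t ∈ Set.Icc (0 : ℝ) 1 := by
  have hk := τ.step_pos h1 hmM
  refine ⟨div_nonneg (sub_nonneg.2 ht.1.le) hk.le, ?_⟩
  rw [TimeMesh.coord, div_le_one hk]
  exact sub_le_sub_right ht.2 _

theorem TimeMesh.setIntegral_coord {m : ℕ} (h1 : 1 ≤ m) (hmM : m ≤ M) (g : ℝ → ℂ) :
    ∫ t in τ.interval m, g (τ.coord m t) = τ.step m * ∫ s in (0 : ℝ)..1, g s := by
  have hk := τ.step_pos h1 hmM
  have := intervalIntegral.integral_comp_div_sub (a := τ.node (m - 1)) (b := τ.node m) g hk.ne'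
    (τ.node (m - 1) / τ.step m)
  simp only [← sub_div] at this
  rw [sub_self, zero_div, show (τ.node m - τ.node (m - 1)) / τ.step m = 1 from div_self hk.ne',
    intervalIntegral.integral_of_le (τ.node_pred_lt h1 hmM).le] at this
  rw [TimeMesh.interval]
  simp only [TimeMesh.coord]
  rw [this, Complex.real_smul]

theorem TimeMesh.eventually_right {m : ℕ} (h1 : 1 ≤ m) (hmM : m ≤ M) {p : ℝ → Prop}
    (h : ∀ t ∈ τ.interval m, p t) :
    ∀ᶠ t in 𝓝[>] (τ.node (m - 1)), p t :=
  Filter.mem_of_superset (Ioc_mem_nhdsGT (τ.node_pred_lt h1 hmM)) h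

theorem TimeMesh.eventually_left {m : ℕ} (h1 : 1 ≤ m) (hmM : m ≤ M) {p : ℝ → Prop}
    (h : ∀ t ∈ τ.interval m, p t) :
    ∀ᶠ t in 𝓝[<] (τ.node m), p t :=
  Filter.mem_of_superset (Ioo_mem_nhdsLT (τ.node_pred_lt h1 hmM)) fun t ht => h t ⟨ht.1, ht.2.le⟩

theorem TimeMesh.rightLim_eq {m : ℕ} (h1 : 1 ≤ m) (hmM : m ≤ M) {V : Type*}
    [TopologicalSpace V] [T2Space V] [Nonempty V] {u v : ℝ → V} (hv : Continuous v)
    (h : ∀ t ∈ τ.interval m, u t = v t) :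
    rightLim u (τ.node (m - 1)) = v (τ.node (m - 1)) := by
  refine Filter.Tendsto.limUnder_eq ?_
  exact (hv.continuousAt.tendsto.mono_left nhdsWithin_le_nhds).congr'
    (τ.eventually_right h1 hmM fun t ht => (h t ht).symm)

theorem TimeMesh.leftLim_eq {m : ℕ} (h1 : 1 ≤ m) (hmM : m ≤ M) {V : Type*}
    [TopologicalSpace V] [T2Space V] [Nonempty V] {u v : ℝ → V} (hv : Continuous v)
    (h : ∀ t ∈ τ.interval m, u t = v t) :
    leftLim u (τ.node m) = v (τ.node m) := by
  refine Filter.Tendsto.limUnder_eq ?_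
  exact (hv.continuousAt.tendsto.mono_left nhdsWithin_le_nhds).congr'
    (τ.eventually_left h1 hmM fun t ht => (h t ht).symm)

theorem TimeMesh.timeDeriv_eq {m : ℕ} {V : Type*} [NormedAddCommGroup V] [NormedSpace ℂ V]
    {u v : ℝ → V} {t : ℝ} (ht : t ∈ τ.interval m) (h : ∀ t ∈ τ.interval m, u t = v t) {v' : V}
    (hv : letI : NormedSpace ℝ V := NormedSpace.complexToReal; HasDerivAt v v' t) :
    τ.timeDeriv m u t = v' := by
  let : NormedSpace ℝ V := NormedSpace.complexToReal
  refine ((hv.hasDerivWithinAt (s := τ.interval m)).congr h (h t ht)).derivWithin ?_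
  exact uniqueDiffOn_Ioc _ _ t ht

end Mesh

/-! ### Spectral facts for the discrete Laplacian, and the scheme on one interval. -/

theorem inner_smul_left_submodule {d : ℕ} {Ω : Set (Space d)} {V : Submodule ℂ (L2 Ω)}
    (c : ℂ) (w x : V) : inner ℂ (c • w) x = (starRingEnd ℂ) c * inner ℂ w x :=
  inner_smul_left w x c

section Laplacian

variable {d : ℕ} {Ω : Set (Space d)} {V : Submodule ℂ (L2 Ω)} [FiniteDimensional ℂ V]
  (hV : V ≤ H10 Ω)

theorem inner_neg_discreteLaplacian (v χ : V) :
    inner ℂ χ ((-discreteLaplacian hV) v) = dirichlet hV v χ :=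
  (discreteLaplacian_eq_iff hV v _).1 rfl χ

theorem isSymmetric_neg_discreteLaplacian : (-discreteLaplacian hV).IsSymmetric := by
  intro v w
  rw [inner_neg_discreteLaplacian, ← inner_conj_symm, inner_neg_discreteLaplacian, dirichlet,
    dirichlet, inner_conj_symm]

/-- An eigenvalue is the Dirichlet energy of its normalized eigenvector. -/
theorem eigenvalues_neg_discreteLaplacian_nonneg {n : ℕ} (hn : Module.finrank ℂ V = n) (i : Fin n) :
    0 ≤ (isSymmetric_neg_discreteLaplacian hV).eigenvalues hn i := by
  set hs := isSymmetric_neg_discreteLaplacian hV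
  have h := inner_neg_discreteLaplacian hV (hs.eigenvectorBasis hn i) (hs.eigenvectorBasis hn i)
  rw [hs.apply_eigenvectorBasis, inner_smul_right, dirichlet, inner_self_eq_norm_sq_to_K,
    inner_self_eq_norm_sq_to_K, (hs.eigenvectorBasis hn).orthonormal.1 i] at h
  have h2 := congrArg Complex.re h
  simp only [Complex.coe_algebraMap, Complex.ofReal_one, one_pow, mul_one, ← Complex.ofReal_pow] at h2
  have h3 : hs.eigenvalues hn i = ‖gradOn hV (hs.eigenvectorBasis hn i)‖ ^ 2 := h2
  rw [h3]
  exact sq_nonneg _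

theorem inner_l2Proj (w : V) (v : L2 Ω) : inner ℂ w (l2Proj V v) = inner ℂ (w : L2 Ω) v :=
  V.inner_orthogonalProjectionOnto_eq_of_mem_left w v

/-- The value of `u` just before `t_{m-1}`. -/
noncomputable def initialValue {T : ℝ} {M : ℕ} (τ : TimeMesh T M) (u₀ : L2 Ω) (u : ℝ → V)
    (m : ℕ) : V :=
  if m = 1 then l2Proj V u₀ else leftLim u (τ.node (m - 1))

theorem jump_eq {T : ℝ} {M : ℕ} (τ : TimeMesh T M) (u₀ : L2 Ω) (u : ℝ → V) (m : ℕ) :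
    jump τ u₀ u m = rightLim u (τ.node (m - 1)) - initialValue τ u₀ u m := by
  unfold jump initialValue
  split_ifs with h
  · rw [h, Nat.sub_self, τ.node_zero]
  · rfl

variable {hV}
variable {T : ℝ} {M : ℕ} {τ : TimeMesh T M} {q : ℕ} {u₀ : L2 Ω} {u : ℝ → V}

/-- Testing the scheme with functions supported on a single interval. -/
theorem IsHomogeneousSolution.local_eq (h : IsHomogeneousSolution hV τ q u₀ u) {m : ℕ}
    (h1 : 1 ≤ m) (hmM : m ≤ M) (w : V) (ψ : TimePoly q) :
    (∫ t in τ.interval m, TimePoly.ev (τ.coord m t) ψ * inner ℂ w (τ.timeDeriv m u t)) +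
      (∫ t in τ.interval m, TimePoly.ev (τ.coord m t) ψ *
        inner ℂ w ((-discreteLaplacian hV) (u t))) +
      TimePoly.ev 0 ψ * inner ℂ w (jump τ u₀ u m) = 0 := by
  classical
  -- The conjugate of `ψ` appears because the inner product is conjugate linear in its first slot;
  -- the tested identity then contains `ψ` itself, matching the bilinear pairing.
  set φ : ℝ → V := fun t => if t ∈ τ.interval m then TimePoly.ev (τ.coord m t) (star ψ) • w else 0
    with hφ
  have hin : ∀ t ∈ τ.interval m, φ t = TimePoly.ev (τ.coord m t) (star ψ) • w :=
    fun t ht => if_pos ht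
  have hout : ∀ t, t ∉ τ.interval m → φ t = 0 := fun t ht => if_neg ht
  have hpoly : IsPiecewisePoly τ q φ := by
    intro m' hm'
    rw [Finset.mem_Icc] at hm'
    rcases eq_or_ne m' m with rfl | hne
    · obtain ⟨e, he⟩ := TimePoly.exists_ev_affine (star ψ) (τ.step m')⁻¹
        (-(τ.node (m' - 1) / τ.step m'))
      refine ⟨fun j => if hj : j < q + 1 then e ⟨j, hj⟩ • w else 0, fun t ht => ?_⟩
      rw [hin t ht]
      have e1 : τ.coord m' t = (τ.step m')⁻¹ * t + -(τ.node (m' - 1) / τ.step m') := by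
        rw [TimeMesh.coord, sub_div]; ring
      rw [e1, he, TimePoly.ev_apply, Finset.sum_range, Finset.sum_smul]
      refine Finset.sum_congr rfl fun j _ => ?_
      simp only [dif_pos j.2, mul_smul]
    · refine ⟨0, fun t ht => ?_⟩
      rw [hout t (τ.notMem_interval hne hmM hm'.2 ht)]
      simp
  have hR : ∀ m', 1 ≤ m' → m' ≤ M → rightLim φ (τ.node (m' - 1)) =
      if m' = m then TimePoly.ev 0 (star ψ) • w else 0 := by
    intro m' h1' h2'
    split_ifs with he
    · subst he
      rw [τ.rightLim_eq h1' h2' (v := fun t => TimePoly.ev (τ.coord m' t) (star ψ) • w) ?_ hin,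
        τ.coord_left]
      refine ((TimePoly.continuous_ev _).comp ?_).smul continuous_const
      unfold TimeMesh.coord
      fun_prop
    · exact τ.rightLim_eq h1' h2' (v := fun _ => 0) continuous_const fun t ht =>
        hout t (τ.notMem_interval he hmM h2' ht)
  have hinner : ∀ t ∈ τ.interval m, ∀ x : V,
      inner ℂ (φ t) x = TimePoly.ev (τ.coord m t) ψ * inner ℂ w x := by
    intro t ht x
    rw [hin t ht, inner_smul_left_submodule, TimePoly.ev_star, Complex.conj_conj]
  have hmeas : MeasurableSet (τ.interval m) := measurableSet_Ioc
  have key := h.2 φ hpoly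
  have T1 : (∑ m' ∈ Finset.Icc 1 M, ∫ t in τ.interval m', inner ℂ (φ t) (τ.timeDeriv m' u t)) =
      ∫ t in τ.interval m, TimePoly.ev (τ.coord m t) ψ * inner ℂ w (τ.timeDeriv m u t) := by
    rw [Finset.sum_eq_single_of_mem m (Finset.mem_Icc.2 ⟨h1, hmM⟩)]
    · exact setIntegral_congr_fun hmeas fun t ht => hinner t ht _
    · intro m' hm' hne
      rw [Finset.mem_Icc] at hm'
      refine setIntegral_eq_zero_of_forall_eq_zero fun t ht => ?_
      rw [hout t (τ.notMem_interval hne hmM hm'.2 ht), inner_zero_left]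
  have T2 : (∫ t in Set.Ioo 0 T, dirichlet hV (u t) (φ t)) =
      ∫ t in τ.interval m, TimePoly.ev (τ.coord m t) ψ *
        inner ℂ w ((-discreteLaplacian hV) (u t)) := by
    rw [← integral_Ioc_eq_integral_Ioo, setIntegral_eq_of_subset_of_forall_sdiff_eq_zero
      (s := τ.interval m) measurableSet_Ioc]
    · refine setIntegral_congr_fun hmeas fun t ht => ?_
      simp only [← inner_neg_discreteLaplacian]
      exact hinner t ht _
    · refine Set.Ioc_subset_Ioc ?_ ?_
      · exact τ.node_zero.symm.le.trans (τ.node_mono (Nat.zero_le _) (by omega))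
      · exact (τ.node_mono hmM le_rfl).trans_eq τ.node_last
    · intro t ht
      rw [← inner_neg_discreteLaplacian, hout t ht.2, inner_zero_left]
  have hev : (starRingEnd ℂ) (TimePoly.ev 0 (star ψ)) = TimePoly.ev 0 ψ := by
    rw [TimePoly.ev_star, Complex.conj_conj]
  have hR1 := hR 1 le_rfl (h1.trans hmM)
  rw [Nat.sub_self, τ.node_zero] at hR1
  rw [formB, T1, T2, ← inner_l2Proj, hR1] at key
  -- For `m = 1` the jump is assembled from the initial term of `B` and the right-hand side, with
  -- `P_h u₀` in place of `u₀`; for `m ≥ 2` both vanish and one term of the jump sum remains.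
  rcases eq_or_ne m 1 with rfl | hm1
  · have T3 : (∑ m' ∈ Finset.Icc 2 M, inner ℂ (rightLim φ (τ.node (m' - 1)))
        (rightLim u (τ.node (m' - 1)) - leftLim u (τ.node (m' - 1)))) = (0 : ℂ) := by
      refine Finset.sum_eq_zero fun m' hm' => ?_
      rw [Finset.mem_Icc] at hm'
      rw [hR m' (by omega) hm'.2, if_neg (by omega), inner_zero_left]
    rw [T3, if_pos rfl, inner_smul_left_submodule, inner_smul_left_submodule, hev] at key
    rw [jump, if_pos rfl, inner_sub_right]
    linear_combination key
  · have T3 : (∑ m' ∈ Finset.Icc 2 M, inner ℂ (rightLim φ (τ.node (m' - 1)))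
        (rightLim u (τ.node (m' - 1)) - leftLim u (τ.node (m' - 1)))) =
        TimePoly.ev 0 ψ * inner ℂ w (rightLim u (τ.node (m - 1)) - leftLim u (τ.node (m - 1))) := by
      rw [Finset.sum_eq_single_of_mem m (Finset.mem_Icc.2 ⟨by omega, hmM⟩)]
      · rw [hR m h1 hmM, if_pos rfl, inner_smul_left_submodule, hev]
      · intro m' hm' hne
        rw [Finset.mem_Icc] at hm'
        rw [hR m' (by omega) hm'.2, if_neg hne, inner_zero_left]
    rw [T3, if_neg (Ne.symm hm1), inner_zero_left, inner_zero_left] at key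
    rw [jump, if_neg hm1]
    linear_combination key

end Laplacian

theorem exists_timePoly_coeff {d : ℕ} {Ω : Set (Space d)} {V : Submodule ℂ (L2 Ω)} {T : ℝ} {M : ℕ}
    {τ : TimeMesh T M} {q : ℕ} {u : ℝ → V} {ι : Type*} [Fintype ι] (b : OrthonormalBasis ι ℂ V)
    (hu : IsPiecewisePoly τ q u) {m : ℕ} (h1 : 1 ≤ m) (hmM : m ≤ M) :
    ∃ p : ι → TimePoly q, ∀ t ∈ τ.interval m,
      u t = ∑ i, TimePoly.ev (τ.coord m t) (p i) • b i := by
  obtain ⟨c, hc⟩ := hu m (Finset.mem_Icc.2 ⟨h1, hmM⟩)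
  have hk := τ.step_pos h1 hmM
  choose p hp using fun i => TimePoly.exists_ev_affine (q := q) (fun j => inner ℂ (b i) (c j))
    (τ.step m) (τ.node (m - 1))
  refine ⟨p, fun t ht => ?_⟩
  rw [← b.sum_repr' (u t)]
  refine Finset.sum_congr rfl fun i _ => ?_
  congr 1
  rw [← hp i, hc t ht, inner_sum, TimePoly.ev_apply, Finset.sum_range]
  refine Finset.sum_congr rfl fun j _ => ?_
  rw [inner_smul_right]
  congr 3
  rw [TimeMesh.coord]
  field_simp
  ring

end DGFE

/-! ### The solution formula and the smoothing estimate -/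

namespace DGFE

section Formula

variable {d : ℕ} {Ω : Set (Space d)} {V : Submodule ℂ (L2 Ω)} {hV : V ≤ H10 Ω}
  {T : ℝ} {M : ℕ} {τ : TimeMesh T M} {q : ℕ} {u₀ : L2 Ω} {u : ℝ → V}
  {ι : Type*} [Fintype ι] {b : OrthonormalBasis ι ℂ V} {lam : ι → ℝ}

theorem continuous_sum_ev_coord (τ : TimeMesh T M) (m : ℕ) (b : ι → V) (p : ι → TimePoly q) :
    Continuous fun t => ∑ i, TimePoly.ev (τ.coord m t) (p i) • b i := by
  refine continuous_finsetSum _ fun i _ => ((TimePoly.continuous_ev _).comp ?_).smul continuous_const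
  unfold TimeMesh.coord
  fun_prop

theorem timeDeriv_sum_ev (τ : TimeMesh T M) {m : ℕ} {p : ι → TimePoly q}
    (hp : ∀ t ∈ τ.interval m, u t = ∑ i, TimePoly.ev (τ.coord m t) (p i) • b i)
    {t : ℝ} (ht : t ∈ τ.interval m) : τ.timeDeriv m u t =
      ∑ i, (TimePoly.ev (τ.coord m t) (TimePoly.der (p i)) * (τ.step m : ℂ)⁻¹) • b i := by
  refine τ.timeDeriv_eq ht hp ?_
  let : NormedSpace ℝ V := NormedSpace.complexToReal
  refine HasDerivAt.fun_sum fun i _ => HasDerivAt.smul_const ?_ _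
  have h1 : HasDerivAt (τ.coord m) (τ.step m)⁻¹ t := by
    have := ((hasDerivAt_id t).sub_const (τ.node (m - 1))).div_const (τ.step m)
    rwa [one_div] at this
  have h2 := (TimePoly.hasDerivAt_ev (p i) (τ.coord m t)).scomp t h1
  refine h2.congr_deriv ?_
  rw [Complex.real_smul, Complex.ofReal_inv, mul_comm]

theorem inner_basis_sum (b : OrthonormalBasis ι ℂ V) (c : ι → ℂ) (i : ι) :
    inner ℂ (b i) (∑ j, c j • b j) = c i := b.orthonormal.inner_right_fintype c i

/-- Rescaling to `[0,1]` multiplies both integrals by `k_m`. It cancels against `1/k_m` in the time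
derivative and stays on the Laplacian term, hence the parameter `k_m λ_i`. -/
theorem IsHomogeneousSolution.isStep [FiniteDimensional ℂ V]
    (h : IsHomogeneousSolution hV τ q u₀ u)
    (hb : ∀ i, (-discreteLaplacian hV) (b i) = (lam i : ℂ) • b i) {m : ℕ} (h1 : 1 ≤ m)
    (hmM : m ≤ M) {p : ι → TimePoly q}
    (hp : ∀ t ∈ τ.interval m, u t = ∑ i, TimePoly.ev (τ.coord m t) (p i) • b i) (i : ι) :
    TimePoly.IsStep (τ.step m * lam i) (inner ℂ (b i) (initialValue τ u₀ u m)) (p i) := by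
  intro φ
  have hk : (τ.step m : ℂ) ≠ 0 := by exact_mod_cast (τ.step_pos h1 hmM).ne'
  have key := h.local_eq h1 hmM (b i) φ
  have hmeas : MeasurableSet (τ.interval m) := measurableSet_Ioc
  have e1 : (∫ t in τ.interval m, TimePoly.ev (τ.coord m t) φ *
      inner ℂ (b i) (τ.timeDeriv m u t)) = TimePoly.pairing (TimePoly.der (p i)) φ := by
    refine (setIntegral_congr_fun hmeas fun t ht => ?_).trans ((τ.setIntegral_coord h1 hmM fun s =>
      TimePoly.ev s φ * (TimePoly.ev s (TimePoly.der (p i)) * (τ.step m : ℂ)⁻¹)).trans ?_)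
    · simp only [timeDeriv_sum_ev τ hp ht, inner_basis_sum]
    · rw [TimePoly.pairing_apply, ← intervalIntegral.integral_const_mul]
      refine intervalIntegral.integral_congr fun s _ => ?_
      field_simp
  have e2 : (∫ t in τ.interval m, TimePoly.ev (τ.coord m t) φ *
      inner ℂ (b i) ((-discreteLaplacian hV) (u t))) =
      τ.step m * lam i * TimePoly.pairing (p i) φ := by
    refine (setIntegral_congr_fun hmeas fun t ht => ?_).trans ((τ.setIntegral_coord h1 hmM fun s =>
      TimePoly.ev s φ * (TimePoly.ev s (p i) * lam i)).trans ?_)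
    · simp only [hp t ht, map_sum, map_smul, hb, smul_smul, inner_basis_sum]
    · rw [TimePoly.pairing_apply, mul_assoc]
      simp only [← intervalIntegral.integral_const_mul]
      refine intervalIntegral.integral_congr fun s _ => ?_
      ring
  have e3 : inner ℂ (b i) (rightLim u (τ.node (m - 1))) = TimePoly.ev 0 (p i) := by
    rw [τ.rightLim_eq h1 hmM (continuous_sum_ev_coord τ m b p) hp, τ.coord_left, inner_basis_sum]
  rw [e1, e2, jump_eq, inner_sub_right, e3] at key
  linear_combination key

theorem step_mul_mem {m : ℕ} (h1 : 1 ≤ m) (hmM : m ≤ M) {l : ℝ} (hl : 0 ≤ l) :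
    0 < ((τ.step m : ℂ) * l).re ∨ (τ.step m : ℂ) * l = 0 := by
  have hk := τ.step_pos h1 hmM
  rcases hl.eq_or_lt with rfl | hl
  · simp
  · left
    rw [← Complex.ofReal_mul, Complex.ofReal_re]
    positivity

theorem IsHomogeneousSolution.inner_initialValue [FiniteDimensional ℂ V]
    (h : IsHomogeneousSolution hV τ q u₀ u)
    (hb : ∀ i, (-discreteLaplacian hV) (b i) = (lam i : ℂ) • b i) (hlam : ∀ i, 0 ≤ lam i) {m : ℕ}
    (h1 : 1 ≤ m) (hmM : m ≤ M) (i : ι) :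
    inner ℂ (b i) (initialValue τ u₀ u m) = (∏ j ∈ Finset.Ico 1 m,
      TimePoly.ev 1 (TimePoly.step q (τ.step j * lam i))) * inner ℂ (b i) (l2Proj V u₀) := by
  induction m, h1 using Nat.le_induction with
  | base => simp [initialValue]
  | succ m hm ih =>
    obtain ⟨p, hp⟩ := exists_timePoly_coeff b h.1 hm (by omega)
    have h2 := (h.isStep hb hm (by omega) hp i).eq_smul_step (step_mul_mem hm (by omega) (hlam i))
    rw [initialValue, if_neg (by omega), Nat.add_sub_cancel,
      τ.leftLim_eq hm (by omega) (continuous_sum_ev_coord τ m b p) hp,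
      τ.coord_right hm (by omega), inner_basis_sum, h2, map_smul, ih (by omega), smul_eq_mul,
      Finset.prod_Ico_succ_top hm]
    ring

end Formula

end DGFE

/-- The smoothing estimate for functionals of the dG solution on the `m`-th interval. -/
theorem exists_seminorm_symbol_le (q : ℕ) {γ : ℝ} (hγ₀ : 0 < γ) (hγ : γ < Real.pi / 2) {κ : ℝ}
    (hκ : 0 < κ) : ∃ C : ℝ, 0 < C ∧ ∀ (W ι : Type) [AddCommGroup W] [Module ℂ W] [Fintype ι]
      (A : Module.End ℂ W) (b : Module.Basis ι ℂ W) (lam : ι → ℝ)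
      (_ : ∀ i, A (b i) = (lam i : ℂ) • b i) (_ : ∀ i, 0 ≤ lam i) (N : Seminorm ℂ W)
      (_ : ∀ v, N v = 0 → v = 0) (Mh : ℝ)
      (_ : ∀ z : ℂ, z ∉ sector γ → ∀ χ : W, N (resolvent A z χ) ≤ Mh / ‖z‖ * N χ)
      (T : ℝ) (M : ℕ) (τ : TimeMesh T M) (_ : τ.RatioBounded κ) (L : TimePoly q →L[ℂ] ℂ) (m : ℕ)
      (_ : 1 ≤ m) (_ : m ≤ M) (c : ι → ℂ),
      N (∑ i, (TimePoly.symbol τ L m (lam i) * c i) • b i) ≤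
        ‖L‖ * (C * Mh / τ.node m * N (∑ i, c i • b i)) := by
  obtain ⟨θ, hγθ, hθ⟩ := exists_between hγ
  have hθ' : |θ| < Real.pi / 2 := by rwa [abs_of_pos (hγ₀.trans hγθ)]
  obtain ⟨a, B, ha, hB, h2⟩ := TimePoly.exists_sectorDecay_symbol q hθ' hκ
  obtain ⟨B', hB', h3⟩ := TimePoly.exists_sectorDecay_symbol_one q hθ'
  -- The first summand serves `m ≥ 2`; the other two serve the decaying part and the remainder for
  -- `m = 1`.
  refine ⟨B / (2 * a) + B' / 2 + 2 * ‖TimePoly.evalRep q‖, by positivity, ?_⟩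
  intro W ι _ _ _ A b lam hA hlam N hN Mh hM T M τ hτ L m h1 hmM c
  have ht := τ.node_pos h1 hmM
  -- The trivial space is separated because `1 ≤ Mh` needs an eigenvector.
  rcases isEmpty_or_nonempty ι with hι | ⟨⟨i₀⟩⟩
  · simp
  have hMh : 1 ≤ Mh := Seminorm.one_le_of_resolvent hN hA hlam hγ hM i₀
  set v := ∑ i, c i • b i
  have hv : 0 ≤ N v := apply_nonneg N v
  rcases h1.lt_or_eq with h1 | rfl
  · have h4 := Seminorm.sum_apply_le_of_sectorDecay hN hA hlam hγ₀ hγθ hθ hM (by positivity)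
      (h2 T M τ hτ L m h1 hmM) c
    refine h4.trans ?_
    change _ * N v ≤ _
    calc _ = ‖L‖ * (B / (2 * a) * Mh / τ.node m * N v) := by field_simp
      _ ≤ _ := by
          gcongr
          linarith [norm_nonneg (TimePoly.evalRep q)]
  · have hk := τ.step_pos le_rfl hmM
    have hkt : τ.step 1 = τ.node 1 := by rw [TimeMesh.step, Nat.sub_self, τ.node_zero, sub_zero]
    have h4 := Seminorm.sum_apply_le_of_sectorDecay hN hA hlam hγ₀ hγθ hθ hM hk
      (h3 L (τ.step 1) hk) c
    have h5 := Seminorm.sum_inv_one_add_le (N := N) hA hlam hγ hM hk c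
    change _ ≤ _ * N v at h4 h5
    set w := ∑ i, (((1 + τ.step 1 * lam i : ℝ) : ℂ)⁻¹ * c i) • b i
    -- The subtracted part is `λ/(1 + kλ) = k⁻¹ (1 - (1 + kλ)⁻¹)`, that is, `k⁻¹ (v - w)` with `w =
    -- (1 + k A)⁻¹ v`.
    have e : ∑ i, (TimePoly.symbol τ L 1 (lam i) * c i) • b i =
        ∑ i, ((lam i * (L (TimePoly.step q (τ.step 1 * lam i)) -
          L (TimePoly.evalRep q) / (1 + τ.step 1 * lam i))) * c i) • b i +
        (L (TimePoly.evalRep q) * (τ.step 1 : ℂ)⁻¹) • (v - w) := by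
      simp only [v, w]
      rw [← Finset.sum_sub_distrib, Finset.smul_sum, ← Finset.sum_add_distrib]
      refine Finset.sum_congr rfl fun i _ => ?_
      rw [← sub_smul, smul_smul, ← add_smul]
      congr 1
      have hk' : (τ.step 1 : ℂ) ≠ 0 := by exact_mod_cast hk.ne'
      have h6 : (1 + τ.step 1 * lam i : ℂ) ≠ 0 := by
        exact_mod_cast (by nlinarith [mul_nonneg hk.le (hlam i)] :
          (0 : ℝ) < 1 + τ.step 1 * lam i).ne'
      have h7 : (lam i : ℂ) * (1 + τ.step 1 * lam i : ℂ)⁻¹ =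
          (τ.step 1 : ℂ)⁻¹ * (1 - (1 + τ.step 1 * lam i : ℂ)⁻¹) := by
        have h8 : (lam i : ℂ) = (τ.step 1 : ℂ)⁻¹ * ((1 + τ.step 1 * lam i) - 1) := by
          rw [add_sub_cancel_left, inv_mul_cancel_left₀ hk']
        generalize (1 + τ.step 1 * lam i : ℂ) = D at h6 h8 ⊢
        rw [h8, mul_assoc, sub_mul, mul_inv_cancel₀ h6, one_mul]
      simp only [TimePoly.symbol, Finset.Ico_self, Finset.prod_empty, mul_one]
      push_cast
      rw [div_eq_mul_inv]
      linear_combination (L (TimePoly.evalRep q) * c i) * h7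
    rw [e]
    have h7 : N ((L (TimePoly.evalRep q) * (τ.step 1 : ℂ)⁻¹) • (v - w)) ≤
        ‖L‖ * (2 * ‖TimePoly.evalRep q‖ * Mh / τ.step 1 * N v) := by
      rw [map_smul_eq_mul, norm_mul, norm_inv, Complex.norm_real, Real.norm_of_nonneg hk.le]
      have h8 : N (v - w) ≤ 2 * Mh * N v := by
        refine (map_sub_le_add N v w).trans ?_
        nlinarith
      have h9 := L.le_opNorm (TimePoly.evalRep q)
      calc _ ≤ (‖L‖ * ‖TimePoly.evalRep q‖) * (τ.step 1)⁻¹ * (2 * Mh * N v) := by gcongr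
        _ = _ := by field_simp
    refine (map_add_le_add N _ _).trans ((add_le_add h4 h7).trans ?_)
    rw [hkt] at hk ⊢
    calc _ = ‖L‖ * ((B' / 2 + 2 * ‖TimePoly.evalRep q‖) * Mh / τ.node 1 * N v) := by
          field_simp
      _ ≤ _ := by
          gcongr
          linarith [show 0 < B / (2 * a) by positivity]

/-- The real suprema would take the default value 0 on unbounded families; the two boundedness
statements exclude this. -/
theorem mainTheorem9 (q : ℕ) (γ : ℝ) (hγ₀ : 0 < γ) (hγ : γ < Real.pi / 2) (κ : ℝ) (hκ : 0 < κ) :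
    ∃ C : ℝ, 0 < C ∧
      ∀ (d : ℕ) (_ : d = 2 ∨ d = 3) (Ω : Set (Space d)) (_ : IsOpen Ω) (𝒯 : Mesh Ω)
        (r : ℕ) (_ : 1 ≤ r) (T : ℝ) (M : ℕ) (τ : TimeMesh T M) (_ : τ.RatioBounded κ)
        (N : Seminorm ℂ (feSpace 𝒯 r)) (_ : ∀ v, N v = 0 → v = 0) (Mh : ℝ)
        (_ : ResolventEstimate (discreteLaplacian (feSpace_le 𝒯 r)) γ N Mh)
        (u₀ : L2 Ω) (u : ℝ → feSpace 𝒯 r)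
        (_ : IsHomogeneousSolution (feSpace_le 𝒯 r) τ q u₀ u)
        (m : ℕ) (_ : 1 ≤ m) (_ : m ≤ M),
        BddAbove (Set.range fun t : τ.interval m => N (τ.timeDeriv m u t)) ∧
        BddAbove (Set.range fun t : τ.interval m =>
          N (discreteLaplacian (feSpace_le 𝒯 r) (u t))) ∧
        (⨆ t : τ.interval m, N (τ.timeDeriv m u t))
          + (⨆ t : τ.interval m, N (discreteLaplacian (feSpace_le 𝒯 r) (u t)))
          + (τ.step m)⁻¹ * N (jump τ u₀ u m)
          ≤ C * Mh / τ.node m * N (l2Proj (feSpace 𝒯 r) u₀) := by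
  obtain ⟨C, hC, hmain⟩ := exists_seminorm_symbol_le q hγ₀ hγ hκ
  set ℓ := TimePoly.evalRep q
  set e : ℝ := ‖ℓ (Fin.last q)‖⁻¹
  have he : 0 < e := inv_pos.2 (norm_pos_iff.2 TimePoly.evalRep_last_ne_zero)
  -- The first two summands bound the time derivative, the third the Laplacian, the last the jump.
  refine ⟨((q + 1) + (q + 1) * ‖ℓ‖ * e + (q + 1) + e) * C, by positivity, ?_⟩
  intro d _ Ω _ 𝒯 r _ T M τ hτ N hN Mh hM u₀ u hu m h1 hmM
  have hs := isSymmetric_neg_discreteLaplacian (feSpace_le 𝒯 r)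
  set b := hs.eigenvectorBasis rfl
  set lam := hs.eigenvalues rfl
  have hb : ∀ i, (-discreteLaplacian (feSpace_le 𝒯 r)) (b i) = (lam i : ℂ) • b i :=
    fun i => hs.apply_eigenvectorBasis rfl i
  have hlam : ∀ i, 0 ≤ lam i := eigenvalues_neg_discreteLaplacian_nonneg (feSpace_le 𝒯 r) rfl
  have hk := τ.step_pos h1 hmM
  have hkc : (τ.step m : ℂ) ≠ 0 := by exact_mod_cast hk.ne'
  set v := l2Proj (feSpace 𝒯 r) u₀ with hv
  set X : ℝ := C * Mh / τ.node m * N v with hX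
  have hbound : ∀ L : TimePoly q →L[ℂ] ℂ,
      N (∑ i, (TimePoly.symbol τ L m (lam i) * inner ℂ (b i) v) • b i) ≤ ‖L‖ * X := by
    intro L
    have := hmain (feSpace 𝒯 r) _ (-discreteLaplacian (feSpace_le 𝒯 r)) b.toBasis lam
      (fun i => by rw [b.coe_toBasis]; exact hb i) hlam N hN Mh hM T M τ hτ L m h1 hmM
      (fun i => inner ℂ (b i) v)
    simp only [b.coe_toBasis, b.sum_repr'] at this
    exact this
  obtain ⟨p, hp⟩ := exists_timePoly_coeff b hu.1 h1 hmM
  have hstep := fun i => hu.isStep hb h1 hmM hp i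
  have hpi : ∀ (L : TimePoly q →L[ℂ] ℂ) i,
      lam i * L (p i) = TimePoly.symbol τ L m (lam i) * inner ℂ (b i) v := by
    intro L i
    rw [(hstep i).eq_smul_step (step_mul_mem h1 hmM (hlam i)), map_smul, smul_eq_mul,
      hu.inner_initialValue hb hlam h1 hmM, TimePoly.symbol]
    ring
  have hbound' : ∀ L : TimePoly q →L[ℂ] ℂ, N (∑ i, (lam i * L (p i)) • b i) ≤ ‖L‖ * X := by
    intro L
    simp only [hpi L]
    exact hbound L
  set lastL : TimePoly q →L[ℂ] ℂ := ContinuousLinearMap.proj (Fin.last q)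
  have hlast : ‖lastL‖ ≤ 1 := ContinuousLinearMap.opNorm_le_bound _ zero_le_one fun x => by
    rw [one_mul]; exact norm_le_pi_norm x _
  have hev : ∀ s ∈ Set.Icc (0 : ℝ) 1,
      ‖LinearMap.toContinuousLinearMap (TimePoly.ev (q := q) s)‖ ≤ q + 1 := fun s hs =>
    ContinuousLinearMap.opNorm_le_bound _ (by positivity) fun x => TimePoly.norm_ev_le hs x
  -- The sign of `Mh` is not given, so nonnegativity is read off the estimate for a nonzero
  -- functional.
  have hX0 : 0 ≤ X := by
    have h2 := (apply_nonneg N _).trans (hbound' (LinearMap.toContinuousLinearMap (TimePoly.ev 0)))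
    refine nonneg_of_mul_nonneg_right h2 ?_
    refine norm_pos_iff.2 fun h0 => ?_
    have := congrArg (fun f : TimePoly q →L[ℂ] ℂ => f (Pi.single 0 1)) h0
    simp [TimePoly.ev_zero] at this
  -- By `IsStep.jump_eq`, `k_m⁻¹ [u]` is a fixed multiple of the symbol sum for the top-coefficient
  -- functional, whose norm is at most 1.
  have hjump : jump τ u₀ u m = -(τ.step m * (ℓ (Fin.last q))⁻¹ : ℂ) •
      ∑ i, (lam i * lastL (p i)) • b i := by
    rw [← b.sum_repr' (jump τ u₀ u m), Finset.smul_sum]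
    refine Finset.sum_congr rfl fun i _ => ?_
    rw [jump_eq, inner_sub_right, τ.rightLim_eq h1 hmM (continuous_sum_ev_coord τ m b p) hp,
      τ.coord_left, inner_basis_sum, (hstep i).jump_eq, smul_smul]
    congr 1
    simp only [lastL, ContinuousLinearMap.proj_apply]
    ring
  have hNjump : (τ.step m)⁻¹ * N (jump τ u₀ u m) ≤ e * X := by
    rw [hjump, map_smul_eq_mul, norm_neg, norm_mul, Complex.norm_real,
      Real.norm_of_nonneg hk.le, norm_inv]
    have h2 : N (∑ i, (lam i * lastL (p i)) • b i) ≤ X :=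
      (hbound' lastL).trans (mul_le_of_le_one_left hX0 hlast)
    calc _ = e * N (∑ i, (lam i * lastL (p i)) • b i) := by simp only [e]; field_simp
      _ ≤ _ := by gcongr
  have hlap : ∀ t ∈ τ.interval m, N (discreteLaplacian (feSpace_le 𝒯 r) (u t)) ≤ (q + 1) * X := by
    intro t ht
    have h2 : discreteLaplacian (feSpace_le 𝒯 r) (u t) = -∑ i, (lam i *
        LinearMap.toContinuousLinearMap (TimePoly.ev (τ.coord m t)) (p i)) • b i := by
      rw [← neg_inj, neg_neg, ← LinearMap.neg_apply, hp t ht, map_sum]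
      refine Finset.sum_congr rfl fun i _ => ?_
      rw [map_smul, hb, smul_smul, mul_comm]
      rfl
    rw [h2, map_neg_eq_map]
    exact (hbound' _).trans (mul_le_mul_of_nonneg_right (hev _ (τ.coord_mem h1 hmM ht)) hX0)
  have hder : ∀ t ∈ τ.interval m, N (τ.timeDeriv m u t) ≤ ((q + 1) + (q + 1) * ‖ℓ‖ * e) * X := by
    intro t ht
    -- Strong form on the interval: `∂_t u = Δ_h u - k_m⁻¹ ℓ(s) [u]` with `s` the local coordinate,
    -- so the derivative inherits the two bounds already proved.
    have h2 : τ.timeDeriv m u t = discreteLaplacian (feSpace_le 𝒯 r) (u t) -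
        (TimePoly.ev (τ.coord m t) ℓ * (τ.step m : ℂ)⁻¹) • jump τ u₀ u m := by
      have h3 : discreteLaplacian (feSpace_le 𝒯 r) (u t) =
          ∑ i, (-(lam i * TimePoly.ev (τ.coord m t) (p i))) • b i := by
        rw [← neg_inj, ← LinearMap.neg_apply, hp t ht, map_sum, ← Finset.sum_neg_distrib]
        refine Finset.sum_congr rfl fun i _ => ?_
        rw [map_smul, hb, smul_smul, mul_comm, neg_smul, neg_neg]
      rw [timeDeriv_sum_ev τ hp ht, h3, ← b.sum_repr' (jump τ u₀ u m), Finset.smul_sum,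
        ← Finset.sum_sub_distrib]
      refine Finset.sum_congr rfl fun i _ => ?_
      rw [jump_eq, inner_sub_right, τ.rightLim_eq h1 hmM (continuous_sum_ev_coord τ m b p) hp,
        τ.coord_left, inner_basis_sum, smul_smul, ← sub_smul]
      congr 1
      have h4 := congrArg (TimePoly.ev (τ.coord m t)) (hstep i).der_add
      simp only [map_add, map_smul, smul_eq_mul, map_zero] at h4
      field_simp
      linear_combination h4
    rw [h2]
    refine (map_sub_le_add N _ _).trans ?_
    rw [map_smul_eq_mul, norm_mul, norm_inv, Complex.norm_real, Real.norm_of_nonneg hk.le, mul_assoc]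
    have h5 := TimePoly.norm_ev_le (τ.coord_mem h1 hmM ht) ℓ
    calc _ ≤ (q + 1) * X + ((q + 1) * ‖ℓ‖) * (e * X) := by
          gcongr
          exact hlap t ht
      _ = _ := by ring
  have hne : Nonempty (τ.interval m) := ⟨⟨τ.node m, τ.node_pred_lt h1 hmM, le_rfl⟩⟩
  refine ⟨⟨_, Set.forall_mem_range.2 fun t => hder t t.2⟩,
    ⟨_, Set.forall_mem_range.2 fun t => hlap t t.2⟩, ?_⟩
  have s1 := ciSup_le fun t : τ.interval m => hder t t.2
  have s2 := ciSup_le fun t : τ.interval m => hlap t t.2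
  refine (add_le_add (add_le_add s1 s2) hNjump).trans (le_of_eq ?_)
  rw [hX]
  ring
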